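/- Let $N\ge 1$, $s\in(0,1)$, $h>0$, and let $\mathscr L^{\pm}$ be the set of Lipschitz functions $g:\mathbb R^N\to\mathbb R$ with $\lim_{|x|\to\infty}g(x)=\pm\infty$. Let $c_s=(1-s)/\omega_{N-1}$, where $\omega_{N-1}$ is the volume of the unit ball of $\mathbb R^{N-1}$ ($\omega_0=1$), and for Lebesgue measurable $F\subset\mathbb R^N$ put $$\mathcal P_s(F)=c_s\int_F\int_{F^c}\frac{dx\,dy}{|x-y|^{N+s}}\in[0,\infty].$$ For $w\in L^\infty(\mathbb R^N\times\mathbb R^N)$ let $\mathrm{div}_s w$ be the distribution $$\langle \mathrm{div}_s w,\varphi\rangle=-\frac{c_s}{2}\int_{\mathbb R^N}\int_{\mathbb R^N}w(x,y)\,\frac{\varphi(x)-\varphi(y)}{|x-y|^{N+s}}\,dx\,dy,\qquad \varphi\in C_c^\infty(\mathbb R^N).$$ **Theorem.** Let $g\in\mathscr L^+$ (respectively $g\in\mathscr L^-$). Then there is a unique function $u=u_h^g\in\mathscr L^+$ (respectively $\mathscr L^-$) for which there exists $z\in L^\infty(\mathbb R^N\times\mathbb R^N)$ such that (a) $\|z\|_{L^\infty}\le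 1$ and $z(x,y)\,(u(x)-u(y))=|u(x)-u(y)|$ for a.e. $(x,y)\in\mathbb R^N\times\mathbb R^N$; (b) $-h\,\mathrm{div}_s z+u=g$ in $\mathcal D'(\mathbb R^N)$. Moreover $\mathrm{Lip}(u)\le\mathrm{Lip}(g)$. In addition, for every $t\in\mathbb R$ the sets $\{u<t\}$ and $\{u\le t\}$ (respectively $\{u>t\}$ and $\{u\ge t\}$) are the minimal and the maximal solution, respectively, of $$\min_F\Big\{\mathcal P_s(F)+\frac1h\int_F(g-t)\,dx\Big\}\qquad\Big(\text{respectively } \min_F\Big\{\mathcal P_s(F)+\frac1h\int_F(t-g)\,dx\Big\}\Big),$$ where $F$ ranges over all Lebesgue measurable subsets of $\mathbb R^N$, the energy takes values in $(-\infty,+\infty]$, and a solution is called minimal (maximal) if it is contained in (contains) every other solution up to a Lebesgue null set. Finally, if $g_1,g_2\in\mathscr L^+\cup\mathscr L^-$ and $g_1\le g_2$, then $u_h^{g_1}\le u_h^{g_2}$. -/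

import Mathlib

open MeasureTheory Filter Set
open scoped ENNReal NNReal ContDiff

namespace FracROF

/-- The class `𝓛⁺` of Lipschitz functions on `ℝᴺ` that tend to `+∞` as `|x| → ∞`. -/
def LPlus (N : ℕ) : Set (EuclideanSpace ℝ (Fin N) → ℝ) :=
  {g | (∃ K : ℝ≥0, LipschitzWith K g) ∧ Tendsto g (Bornology.cobounded _) atTop}

/-- The class `𝓛⁻` of Lipschitz functions on `ℝᴺ` that tend to `-∞` as `|x| → ∞`. -/
def LMinus (N : ℕ) : Set (EuclideanSpace ℝ (Fin N) → ℝ) :=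
  {g | (∃ K : ℝ≥0, LipschitzWith K g) ∧ Tendsto g (Bornology.cobounded _) atBot}

/-- The constant `c_s = (1 - s) / ω_{N-1}`, where `ω_{N-1}` is the volume of the unit ball
of `ℝᴺ⁻¹` (used for `N ≥ 1` only). -/
noncomputable def cs (N : ℕ) (s : ℝ) : ℝ :=
  (1 - s) / (volume (Metric.ball (0 : EuclideanSpace ℝ (Fin (N - 1))) 1)).toReal

/-- The `s`-fractional perimeter `c_s ∫_E ∫_{Eᶜ} |x - y|^{-(N+s)} dy dx`, with values in `[0, ∞]`. -/
noncomputable def fracPer {N : ℕ} (s : ℝ) (E : Set (EuclideanSpace ℝ (Fin N))) : ℝ≥0∞ :=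
  ENNReal.ofReal (cs N s) *
    ∫⁻ x in E, ∫⁻ y in Eᶜ, ENNReal.ofReal (1 / ‖x - y‖ ^ ((N : ℝ) + s))

/-- The nonlocal gradient `(∇_s φ)(x, y) = (c_s / 2) (φ(x) - φ(y)) / |x - y|^{N+s}`
(only its values off the diagonal, a set of full measure, matter). -/
noncomputable def nonlocalGrad {N : ℕ} (s : ℝ) (φ : EuclideanSpace ℝ (Fin N) → ℝ)
    (p : EuclideanSpace ℝ (Fin N) × EuclideanSpace ℝ (Fin N)) : ℝ :=
  cs N s / 2 * ((φ p.1 - φ p.2) / ‖p.1 - p.2‖ ^ ((N : ℝ) + s))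

/-- The nonlocal divergence of `w`, paired with `φ`:
`⟨div_s w, φ⟩ = - ∫∫ w(x, y) (∇_s φ)(x, y) dx dy`.
For `0 < s < 1`, `w` in `L^∞` and `φ` Lipschitz with compact support the integral converges
absolutely. -/
noncomputable def nonlocalDiv {N : ℕ} (s : ℝ)
    (w : EuclideanSpace ℝ (Fin N) × EuclideanSpace ℝ (Fin N) → ℝ)
    (φ : EuclideanSpace ℝ (Fin N) → ℝ) : ℝ :=
  -∫ p, w p * nonlocalGrad s φ p

/-- `z` is in `L^∞(ℝᴺ × ℝᴺ)`, has norm at most `1`, and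
`z(x, y) (u(x) - u(y)) = |u(x) - u(y)|` for a.e. `(x, y)`. -/
def IsCalibration {N : ℕ} (u : EuclideanSpace ℝ (Fin N) → ℝ)
    (z : EuclideanSpace ℝ (Fin N) × EuclideanSpace ℝ (Fin N) → ℝ) : Prop :=
  MemLp z ∞ volume ∧ eLpNorm z ∞ volume ≤ 1 ∧
    ∀ᵐ p ∂(volume : Measure (EuclideanSpace ℝ (Fin N) × EuclideanSpace ℝ (Fin N))),
      z p * (u p.1 - u p.2) = |u p.1 - u p.2|

/-- The equation `-h div_s z + u = g` in the sense of distributions on `ℝᴺ`: both sides agree on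
every smooth test function with compact support. -/
def SolvesEquation {N : ℕ} (s h : ℝ) (g u : EuclideanSpace ℝ (Fin N) → ℝ)
    (z : EuclideanSpace ℝ (Fin N) × EuclideanSpace ℝ (Fin N) → ℝ) : Prop :=
  ∀ φ : EuclideanSpace ℝ (Fin N) → ℝ, ContDiff ℝ ∞ φ → HasCompactSupport φ →
    -h * nonlocalDiv s z φ + ∫ x, u x * φ x = ∫ x, g x * φ x

/-- `u` solves the problem with datum `g`: together with some field `z` it satisfies the
conditions on `z` and the equation. -/
def IsSolution {N : ℕ} (s h : ℝ) (g u : EuclideanSpace ℝ (Fin N) → ℝ) : Prop :=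
  ∃ z : EuclideanSpace ℝ (Fin N) × EuclideanSpace ℝ (Fin N) → ℝ,
    IsCalibration u z ∧ SolvesEquation s h g u z

/-- The extended integral `∫_F f = ∫_F f⁺ - ∫_F f⁻` (meaningful when the negative part has
a finite integral). -/
noncomputable def extIntegral {N : ℕ} (f : EuclideanSpace ℝ (Fin N) → ℝ)
    (F : Set (EuclideanSpace ℝ (Fin N))) : EReal :=
  ((∫⁻ x in F, ENNReal.ofReal (f x) : ℝ≥0∞) : EReal) -
    ((∫⁻ x in F, ENNReal.ofReal (-f x) : ℝ≥0∞) : EReal)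

/-- The geometric energy `P_s(F) + (1/h) ∫_F f`. -/
noncomputable def energy {N : ℕ} (s h : ℝ) (f : EuclideanSpace ℝ (Fin N) → ℝ)
    (F : Set (EuclideanSpace ℝ (Fin N))) : EReal :=
  (fracPer s F : EReal) + ((1 / h : ℝ) : EReal) * extIntegral f F

/-- `F` is a solution of the problem of minimizing `Φ` among all Lebesgue measurable sets. -/
def IsMinimizer {N : ℕ} (Φ : Set (EuclideanSpace ℝ (Fin N)) → EReal)
    (F : Set (EuclideanSpace ℝ (Fin N))) : Prop :=
  NullMeasurableSet F volume ∧ ∀ G, NullMeasurableSet G volume → Φ F ≤ Φ G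

/-- `F` is the minimal solution: a solution contained, up to a null set, in every solution. -/
def IsMinimalMinimizer {N : ℕ} (Φ : Set (EuclideanSpace ℝ (Fin N)) → EReal)
    (F : Set (EuclideanSpace ℝ (Fin N))) : Prop :=
  IsMinimizer Φ F ∧ ∀ G, IsMinimizer Φ G → volume (F \ G) = 0

/-- `F` is the maximal solution: a solution containing, up to a null set, every solution. -/
def IsMaximalMinimizer {N : ℕ} (Φ : Set (EuclideanSpace ℝ (Fin N)) → EReal)
    (F : Set (EuclideanSpace ℝ (Fin N))) : Prop :=
  IsMinimizer Φ F ∧ ∀ G, IsMinimizer Φ G → volume (G \ F) = 0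

end FracROF

/-! The equation is the Euler-Lagrange equation of a convex nonlocal total-variation problem, with
`z` playing the role of the sign of u(x) - u(y). Existence comes from regularization: the sign
becomes a bounded Lipschitz monotone function and the kernel an integrable one. The regularized
equation is a fixed-point problem for a map that is order preserving and commutes with translations;
hence it is a contraction and keeps the Lipschitz constant of `g` (`nonlocalOp_shift_le`,
`exists_regularized_solution`). Testing with a tent function bounds u - g uniformly, so a
subsequence converges pointwise and the fields converge weakly-*. Where u(x) ≠ u(y) the field limit
is the sign of u(x) - u(y); elsewhere the calibration identity is void, so any weak-* limit is
admissible (`exists_weak_solution`).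

Uniqueness and monotonicity come from subtracting two equations and testing with the positive part
of min(u₁, T) - u₂. Its support is compact because u₂ tends to +∞, and the nonlocal term has a sign
because calibrations are monotone (`comparison_of_mem_LPlus`).

For the geometric problem the equation is tested with indicator functions. The bound |z| ≤ 1 gives
∫_F (u - g) ≤ h P_s(F), with equality when F is a sublevel set of u. The energy of F is therefore at
least (1/h) ∫_F (u - t), with equality on sublevel sets, and the latter integral is minimal exactly
for the sets between {u < t} and {u ≤ t} (`WeakEquation.isMinimizer`). The class 𝓛⁻ follows by
changing the signs of g, u and z. -/

namespace FracROF

/-! ### The regularized equation: bounded monotone nonlinearity and integrable kernel. -/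

section Regularized

variable {E : Type*} [NormedAddCommGroup E] [MeasurableSpace E] {μ : Measure E}

/-- The operator `u ↦ ∫ β (u x - u (x + v)) k v dv`. -/
noncomputable def nonlocalOp (μ : Measure E) (β : ℝ → ℝ) (k u : E → ℝ) (x : E) : ℝ :=
  ∫ v, β (u x - u (x + v)) * k v ∂μ

lemma abs_nonlocalOp_le {β : ℝ → ℝ} {k : E → ℝ} (u : E → ℝ)
    (hb : ∀ r, |β r| ≤ 1) (hk : Integrable k μ) (hk0 : ∀ v, 0 ≤ k v) (x : E) :
    |nonlocalOp μ β k u x| ≤ ∫ v, k v ∂μ := by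
  rw [← Real.norm_eq_abs]
  refine norm_integral_le_of_norm_le hk (ae_of_all _ fun v => ?_)
  rw [norm_mul, Real.norm_eq_abs, Real.norm_of_nonneg (hk0 v)]
  exact mul_le_of_le_one_left (hk0 v) (hb _)

variable [BorelSpace E]

lemma integrable_nonlocalOp {β : ℝ → ℝ} {k u : E → ℝ} (hβ : Continuous β)
    (hb : ∀ r, |β r| ≤ 1) (hk : Integrable k μ) (hu : Continuous u) (x : E) :
    Integrable (fun v => β (u x - u (x + v)) * k v) μ := by
  refine hk.bdd_mul (c := 1) (Continuous.aestronglyMeasurable (by fun_prop)) ?_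
  exact ae_of_all _ fun v => by simpa using hb _

/-- Since r ↦ L r - β(r) is nondecreasing, u ↦ l u - (operator applied to u), with l = L ∫ k,
preserves order. Two different base points give preservation of the Lipschitz constant; equal base
points, with c a sup distance, give the contraction estimate. -/
lemma nonlocalOp_shift_le {β : ℝ → ℝ} {k u₁ u₂ : E → ℝ} {L : ℝ≥0} (hβm : Monotone β)
    (hβL : LipschitzWith L β) (hb : ∀ r, |β r| ≤ 1) (hk : Integrable k μ) (hk0 : ∀ v, 0 ≤ k v)
    (hu₁ : Continuous u₁) (hu₂ : Continuous u₂) {x₁ x₂ : E} {c : ℝ}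
    (hle : ∀ v, u₁ (x₁ + v) ≤ u₂ (x₂ + v) + c) :
    (L * ∫ v, k v ∂μ) * u₁ x₁ - nonlocalOp μ β k u₁ x₁ ≤
      (L * ∫ v, k v ∂μ) * (u₂ x₂ + c) - nonlocalOp μ β k u₂ x₂ := by
  have h0 : u₁ x₁ ≤ u₂ x₂ + c := by simpa using hle 0
  have key : nonlocalOp μ β k u₂ x₂ - nonlocalOp μ β k u₁ x₁ ≤
      ∫ v, (L * (u₂ x₂ + c - u₁ x₁)) * k v ∂μ := by
    rw [nonlocalOp, nonlocalOp, ← integral_sub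
      (integrable_nonlocalOp hβL.continuous hb hk hu₂ x₂)
      (integrable_nonlocalOp hβL.continuous hb hk hu₁ x₁)]
    refine integral_mono ((integrable_nonlocalOp hβL.continuous hb hk hu₂ x₂).sub
      (integrable_nonlocalOp hβL.continuous hb hk hu₁ x₁)) (hk.const_mul _) fun v => ?_
    simp only
    rw [← sub_mul]
    refine mul_le_mul_of_nonneg_right ?_ (hk0 v)
    have h1 : β (u₂ x₂ - u₂ (x₂ + v)) ≤ β (u₂ x₂ + c - u₁ (x₁ + v)) :=
      hβm (by linarith [hle v])
    have h2 := (le_abs_self _).trans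
      (hβL.dist_le_mul (u₂ x₂ + c - u₁ (x₁ + v)) (u₁ x₁ - u₁ (x₁ + v)))
    rw [Real.dist_eq, abs_of_nonneg (by linarith)] at h2
    linarith
  rw [integral_const_mul] at key
  linarith

/-- The equation says that u is a fixed point of u ↦ (g + l u - operator(u)) / (1 + l), a
contraction of factor l / (1 + l) in the sup distance. As g may be unbounded, the unknown is the
bounded function w = u - g, confined to the closed set where g + w is K-Lipschitz. -/
theorem exists_regularized_solution {β : ℝ → ℝ} {k g : E → ℝ} {L K : ℝ≥0} (hβm : Monotone β)
    (hβL : LipschitzWith L β) (hb : ∀ r, |β r| ≤ 1) (hk : Integrable k μ) (hk0 : ∀ v, 0 ≤ k v)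
    (hg : LipschitzWith K g) :
    ∃ u : E → ℝ, LipschitzWith K u ∧ ∀ x, u x + nonlocalOp μ β k u x = g x := by
  set l : ℝ := L * ∫ v, k v ∂μ with hl
  have hl0 : 0 ≤ l := mul_nonneg L.2 (integral_nonneg hk0)
  have hl1 : 0 < 1 + l := by linarith
  let S : Set (BoundedContinuousFunction E ℝ) := {w | LipschitzWith K fun x => g x + w x}
  have hS : IsClosed S := by
    have : S = ⋂ x, ⋂ y, {w : BoundedContinuousFunction E ℝ |
        dist (g x + w x) (g y + w y) ≤ K * dist x y} := by
      ext w; simp [S, lipschitzWith_iff_dist_le_mul]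
    rw [this]
    refine isClosed_iInter fun x => isClosed_iInter fun y => isClosed_le ?_ continuous_const
    have (x : E) : Continuous fun w : BoundedContinuousFunction E ℝ => w x :=
      (BoundedContinuousFunction.lipschitz_eval_const x).continuous
    fun_prop
  let step (w : BoundedContinuousFunction E ℝ) (x : E) : ℝ :=
    (l * w x - nonlocalOp μ β k (fun y => g y + w y) x) / (1 + l)
  have hstep (w : BoundedContinuousFunction E ℝ) (x : E) : g x + step w x =
      (g x + (l * (g x + w x) - nonlocalOp μ β k (fun y => g y + w y) x)) / (1 + l) := by
    simp only [step]; field_simp; ring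
  have hcont (w : BoundedContinuousFunction E ℝ) : Continuous fun y => g y + w y :=
    hg.continuous.add w.continuous
  have hlip (w : BoundedContinuousFunction E ℝ) (hw : w ∈ S) :
      LipschitzWith K fun x => g x + step w x := by
    refine LipschitzWith.of_le_add_mul K fun x y => ?_
    have h1 := nonlocalOp_shift_le (x₁ := x) (x₂ := y) (c := K * dist x y) hβm hβL hb hk hk0
      (hcont w) (hcont w) fun v => by
        have := (lipschitzWith_iff_dist_le_mul.1 hw) (x + v) (y + v)
        rw [dist_add_right] at this
        linarith [(abs_le.1 (Real.dist_eq _ _ ▸ this)).2]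
    have h2 := (abs_le.1 (Real.dist_eq _ _ ▸ hg.dist_le_mul x y)).2
    rw [hstep, hstep, div_add' _ _ _ hl1.ne', div_le_div_iff_of_pos_right hl1]
    linarith
  have hbd (w : BoundedContinuousFunction E ℝ) (x : E) :
      |step w x| ≤ (l * ‖w‖ + ∫ v, k v ∂μ) / (1 + l) := by
    simp only [step]
    rw [abs_div, abs_of_pos hl1]
    refine div_le_div_of_nonneg_right ?_ hl1.le
    refine (abs_sub _ _).trans (add_le_add ?_ (abs_nonlocalOp_le _ hb hk hk0 x))
    rw [abs_mul, abs_of_nonneg hl0]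
    exact mul_le_mul_of_nonneg_left (w.norm_coe_le_norm x) hl0
  let f (w : S) : S := ⟨BoundedContinuousFunction.ofNormedAddCommGroup (step w.1)
    (by have := (hlip w.1 w.2).continuous.sub hg.continuous
        simpa [Pi.sub_def] using this) _ (fun x => by simpa using hbd w.1 x), hlip w.1 w.2⟩
  have hf (w : S) (x : E) : (f w).1 x = step w.1 x := rfl
  have hone (w w' : S) (x : E) : step w.1 x - step w'.1 x ≤ l / (1 + l) * dist w.1 w'.1 := by
    have h1 := nonlocalOp_shift_le (x₁ := x) (x₂ := x) (c := dist w.1 w'.1) hβm hβL hb hk hk0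
      (hcont w.1) (hcont w'.1) fun v => by
        have := w.1.dist_coe_le_dist (g := w'.1) (x + v)
        linarith [(abs_le.1 (Real.dist_eq _ _ ▸ this)).2]
    simp only [step]
    rw [← sub_div, div_mul_eq_mul_div, div_le_div_iff_of_pos_right hl1]
    linarith
  have hcontr : ContractingWith (Real.toNNReal (l / (1 + l))) f := by
    constructor
    · rw [← NNReal.coe_lt_coe, Real.coe_toNNReal _ (by positivity), NNReal.coe_one,
        div_lt_one hl1]
      linarith
    · refine LipschitzWith.of_dist_le_mul fun w w' => ?_
      rw [Real.coe_toNNReal _ (by positivity)]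
      refine (BoundedContinuousFunction.dist_le (by positivity)).2 fun x => ?_
      rw [Real.dist_eq, abs_le]
      have h1 := hone w w' x
      have h2 := hone w' w x
      rw [dist_comm] at h2
      constructor <;> simp only [hf, Subtype.dist_eq] <;> linarith
  have : CompleteSpace S := hS.isComplete.completeSpace_coe
  have : Nonempty S := ⟨⟨0, by simpa [S] using hg⟩⟩
  set w := hcontr.fixedPoint
  have hw : f w = w := hcontr.fixedPoint_isFixedPt
  refine ⟨fun x => g x + w.1 x, w.2, fun x => ?_⟩
  have := hf w x
  rw [hw, eq_div_iff hl1.ne'] at this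
  linarith

variable [NormedSpace ℝ E] [FiniteDimensional ℝ E] [μ.IsAddHaarMeasure]

lemma integrable_mul_kernel {k f : E → ℝ} {z : E × E → ℝ} (hz : AEStronglyMeasurable z (μ.prod μ))
    (hb : ∀ p, |z p| ≤ 1) (hk : Integrable k μ) (hf : Integrable f μ) :
    Integrable (fun p : E × E => z p * (f p.1 * k (p.1 - p.2))) (μ.prod μ) := by
  refine Integrable.bdd_mul (c := 1) ?_ hz (ae_of_all _ fun p => by simpa using hb p)
  simpa [Function.comp_def] using
    (hf.convolution_integrand (ContinuousLinearMap.mul ℝ ℝ) hk.comp_neg).swap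

/-- Swapping the two variables changes the sign of the β factor (odd) and leaves the kernel (even)
unchanged; averaging the two forms produces f(x) - f(y) and the factor 1/2. -/
theorem regularized_weak_form {β : ℝ → ℝ} {k g u f : E → ℝ} (hβ : Continuous β)
    (hβo : ∀ r, β (-r) = - β r)
    (hb : ∀ r, |β r| ≤ 1) (hk : Integrable k μ) (hke : ∀ v, k (-v) = k v) (hu : Continuous u)
    (heq : ∀ x, u x + nonlocalOp μ β k u x = g x) (hf : Integrable f μ) :
    ∫ x, (u x - g x) * f x ∂μ =
      -(1 / 2) * ∫ p, β (u p.1 - u p.2) * (k (p.1 - p.2) * (f p.1 - f p.2)) ∂(μ.prod μ) := by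
  have hint := integrable_mul_kernel (μ := μ) (z := fun p => β (u p.1 - u p.2))
    (Continuous.aestronglyMeasurable (by fun_prop)) (fun p => hb _) hk hf
  have hswap := hint.swap
  have h1 : ∫ p, β (u p.1 - u p.2) * (k (p.1 - p.2) * (f p.1 - f p.2)) ∂(μ.prod μ) =
      2 * ∫ p, β (u p.1 - u p.2) * (f p.1 * k (p.1 - p.2)) ∂(μ.prod μ) := by
    have h2 := integral_prod_swap (μ := μ) (ν := μ)
      fun p : E × E => β (u p.1 - u p.2) * (f p.1 * k (p.1 - p.2))
    rw [two_mul]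
    nth_rewrite 2 [← h2]
    rw [← integral_add hint (by simpa [Function.comp_def] using hswap)]
    refine integral_congr_ae (ae_of_all _ fun p => ?_)
    have e1 : k (p.2 - p.1) = k (p.1 - p.2) := by rw [← hke, neg_sub]
    have e2 : β (u p.2 - u p.1) = - β (u p.1 - u p.2) := by rw [← hβo, neg_sub]
    simp only [Prod.fst_swap, Prod.snd_swap, e1, e2]
    ring
  rw [h1, integral_prod _ hint]
  rw [show ∀ a : ℝ, -(1 / 2) * (2 * a) = -a by intro a; ring, ← integral_neg]
  refine integral_congr_ae (ae_of_all _ fun x => ?_)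
  have h3 : ∫ y, β (u x - u y) * (f x * k (x - y)) ∂μ = f x * nonlocalOp μ β k u x := by
    rw [nonlocalOp, ← integral_const_mul, ← integral_add_left_eq_self _ x]
    refine integral_congr_ae (ae_of_all _ fun v => ?_)
    simp only
    rw [show x - (x + v) = -v by abel, hke]
    ring
  simp only
  rw [h3, ← heq x]
  ring

end Regularized

end FracROF

namespace FracROF

/-! ### Weak-* compactness in L^∞. -/

section WeakStar

open Topology

variable {α : Type*} [MeasurableSpace α] [MeasurableSpace.CountablyGenerated α]

/-- On a finite measure space the unit ball of L^∞ is bounded in L², which is separable here, so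
sequential Banach-Alaoglu and the Riesz representation apply. -/
lemma exists_weak_subseq_L2 (ν : Measure α) [IsFiniteMeasure ν] (z : ℕ → α → ℝ)
    (hz : ∀ n, AEStronglyMeasurable (z n) ν) (hb : ∀ n x, |z n x| ≤ 1) :
    ∃ w : Lp ℝ 2 ν, ∃ φ : ℕ → ℕ, StrictMono φ ∧ ∀ f : α → ℝ, MemLp f 2 ν →
      Tendsto (fun n => ∫ x, z (φ n) x * f x ∂ν) atTop (𝓝 (∫ x, w x * f x ∂ν)) := by
  have hz2 (n : ℕ) : MemLp (z n) 2 ν :=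
    MemLp.of_bound (hz n) 1 (ae_of_all _ fun x => by simpa using hb n x)
  let Z (n : ℕ) : Lp ℝ 2 ν := (hz2 n).toLp
  have hZ (n : ℕ) : ‖Z n‖ ≤ ν.real univ ^ (2 : ℝ≥0∞).toReal⁻¹ := by
    have := Lp.norm_le_of_ae_bound (f := Z n) (C := 1) zero_le_one (by
      filter_upwards [(hz2 n).coeFn_toLp] with x hx
      rw [hx]; simpa using hb n x)
    simpa [measureUnivNNReal, Measure.real, ENNReal.toReal] using this
  let T (n : ℕ) : WeakDual ℝ (Lp ℝ 2 ν) :=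
    StrongDual.toWeakDual (InnerProductSpace.toDual ℝ (Lp ℝ 2 ν) (Z n))
  have : Fact ((2 : ℝ≥0∞) ≠ ⊤) := ⟨ENNReal.ofNat_ne_top⟩
  obtain ⟨ℓ, -, φ, hφ, hlim⟩ := WeakDual.isSeqCompact_closedBall ℝ (Lp ℝ 2 ν) 0
    (ν.real univ ^ (2 : ℝ≥0∞).toReal⁻¹) (x := T) fun n => by
      simpa [T] using hZ n
  refine ⟨(InnerProductSpace.toDual ℝ (Lp ℝ 2 ν)).symm (WeakDual.toStrongDual ℓ), φ, hφ,
    fun f hf => ?_⟩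
  have h1 := (WeakDual.eval_continuous (𝕜 := ℝ) (E := Lp ℝ 2 ν) hf.toLp).tendsto ℓ |>.comp hlim
  have h2 (a : Lp ℝ 2 ν) : inner ℝ a hf.toLp = ∫ x, a x * f x ∂ν := by
    rw [L2.inner_def]
    refine integral_congr_ae ?_
    filter_upwards [hf.coeFn_toLp] with x hx
    rw [hx]; simp [mul_comm]
  have h3 (n : ℕ) : ∫ x, Z n x * f x ∂ν = ∫ x, z n x * f x ∂ν := by
    refine integral_congr_ae ?_
    filter_upwards [(hz2 n).coeFn_toLp] with x hx
    rw [hx]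
  have h4 : ℓ hf.toLp = inner ℝ
      ((InnerProductSpace.toDual ℝ (Lp ℝ 2 ν)).symm (WeakDual.toStrongDual ℓ)) hf.toLp := by
    rw [InnerProductSpace.toDual_symm_apply]; rfl
  rw [← h2, ← h4]
  refine h1.congr fun n => ?_
  rw [← h3, ← h2]
  rfl

/-- Sequential weak-* compactness of the unit ball of `L^∞`, tested against `L¹` functions. -/
theorem exists_weakStar_subseq (μ : Measure α) [SigmaFinite μ] (z : ℕ → α → ℝ)
    (hz : ∀ n, AEStronglyMeasurable (z n) μ) (hb : ∀ n x, |z n x| ≤ 1) :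
    ∃ w : α → ℝ, Measurable w ∧ (∀ x, |w x| ≤ 1) ∧ ∃ φ : ℕ → ℕ, StrictMono φ ∧
      ∀ f : α → ℝ, Integrable f μ →
        Tendsto (fun n => ∫ x, z (φ n) x * f x ∂μ) atTop (𝓝 (∫ x, w x * f x ∂μ)) := by
  -- A positive density ρ of finite mass replaces μ by a finite measure ν = ρ μ; a function f in
  -- L¹(μ) corresponds to f / ρ in L¹(ν).
  obtain ⟨ρ, hρ0, hρm, hρ⟩ := exists_pos_lintegral_lt_of_sigmaFinite μ one_ne_zero
  set ν := μ.withDensity fun x => (ρ x : ℝ≥0∞) with hν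
  have hνfin : IsFiniteMeasure ν := isFiniteMeasure_withDensity (hρ.trans ENNReal.one_lt_top).ne
  have hac : ν ≪ μ := withDensity_absolutelyContinuous _ _
  obtain ⟨w₀, φ, hφ, hlim⟩ := exists_weak_subseq_L2 ν z (fun n => (hz n).mono_ac hac) hb
  have hzi (n : ℕ) : Integrable (z n) ν :=
    Integrable.of_bound ((hz n).mono_ac hac) 1 (ae_of_all _ fun x => by simpa using hb n x)
  have hw₀i : Integrable w₀ ν := (Lp.memLp w₀).integrable (by norm_num)
  have hset (A : Set α) (hA : MeasurableSet A) :
      Tendsto (fun n => ∫ x in A, z (φ n) x ∂ν) atTop (𝓝 (∫ x in A, w₀ x ∂ν)) := by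
    have := hlim (A.indicator 1) ((memLp_const (1 : ℝ)).indicator hA)
    simpa [← Pi.one_def, ← indicator_mul_right, integral_indicator hA] using this
  -- Testing with indicators shows that the pointwise bounds pass to the weak limit almost
  -- everywhere; the clamping below makes them hold everywhere.
  have habs : ∀ᵐ x ∂ν, |w₀ x| ≤ 1 := by
    have h1 : ∀ᵐ x ∂ν, w₀ x ≤ 1 :=
      ae_le_of_forall_setIntegral_le hw₀i (integrable_const 1) fun A hA _ =>
        le_of_tendsto (hset A hA) (Eventually.of_forall fun n =>
          integral_mono (hzi _).integrableOn (integrable_const _)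
            fun x => (abs_le.1 (hb _ x)).2)
    have h2 : ∀ᵐ x ∂ν, -1 ≤ w₀ x :=
      ae_le_of_forall_setIntegral_le (integrable_const (-1)) hw₀i fun A hA _ =>
        ge_of_tendsto (hset A hA) (Eventually.of_forall fun n =>
          integral_mono (integrable_const _) (hzi _).integrableOn
            fun x => (abs_le.1 (hb _ x)).1)
    filter_upwards [h1, h2] with x h1 h2 using abs_le.2 ⟨h2, h1⟩
  have hw₀m := (Lp.aestronglyMeasurable w₀).aemeasurable
  set w : α → ℝ := fun x => max (-1) (min 1 (hw₀m.mk w₀ x)) with hw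
  have hwm : Measurable w := measurable_const.max (measurable_const.min hw₀m.measurable_mk)
  have hwb (x : α) : |w x| ≤ 1 :=
    abs_le.2 ⟨le_max_left _ _, max_le (by norm_num) (min_le_left _ _)⟩
  have hww : ∀ᵐ x ∂ν, w₀ x = w x := by
    filter_upwards [habs, hw₀m.ae_eq_mk] with x h1 h2
    rw [hw]
    simp only [← h2]
    rw [min_eq_right (abs_le.1 h1).2, max_eq_right (abs_le.1 h1).1]
  have htend (η : α → ℝ) (hη : Integrable η ν) :
      Tendsto (fun n => ∫ x, z (φ n) x * η x ∂ν) atTop (𝓝 (∫ x, w x * η x ∂ν)) := by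
    have hmul {y : α → ℝ} (hy : AEStronglyMeasurable y ν) (hyb : ∀ x, |y x| ≤ 1) {θ : α → ℝ}
        (hθ : Integrable θ ν) : Integrable (fun x => y x * θ x) ν :=
      hθ.bdd_mul (c := 1) hy (ae_of_all _ fun x => by simpa using hyb x)
    have hest {y : α → ℝ} (hyb : ∀ x, |y x| ≤ 1) {θ : α → ℝ}
        (hθ : Integrable θ ν) : |∫ x, y x * θ x ∂ν| ≤ ∫ x, |θ x| ∂ν := by
      rw [← Real.norm_eq_abs]
      refine norm_integral_le_of_norm_le hθ.abs (ae_of_all _ fun x => ?_)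
      rw [norm_mul, Real.norm_eq_abs, Real.norm_eq_abs]
      exact mul_le_of_le_one_left (abs_nonneg _) (hyb x)
    have hηs := hη.1.aemeasurable
    set η' := hηs.mk η
    have hη'm : Measurable η' := hηs.measurable_mk
    have hηη' : η =ᵐ[ν] η' := hηs.ae_eq_mk
    have hη' : Integrable η' ν := hη.congr hηη'
    -- Weak L² convergence only admits L² test functions, so η is truncated at height m; the
    -- remainder is small in L¹, uniformly in n because |z| ≤ 1.
    let τ (m : ℕ) : α → ℝ := {x | |η' x| ≤ m}.indicator η'
    have hτset (m : ℕ) : MeasurableSet {x | |η' x| ≤ m} :=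
      measurableSet_le hη'm.abs measurable_const
    have hτi (m : ℕ) : Integrable (τ m) ν := hη'.indicator (hτset m)
    have hτ2 (m : ℕ) : MemLp (τ m) 2 ν :=
      MemLp.of_bound (hτi m).1 m (ae_of_all _ fun x => by
        by_cases hx : |η' x| ≤ m <;> simp [τ, hx])
    have hτlim : Tendsto (fun m => ∫ x, |η x - τ m x| ∂ν) atTop (𝓝 0) := by
      have := tendsto_integral_of_dominated_convergence (μ := ν) (F := fun m x => |η x - τ m x|)
        (f := fun _ => 0) (fun x => |η x|) (fun m => (hη.sub (hτi m)).abs.1) hη.abs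
        (fun m => by
          filter_upwards [hηη'] with x hx
          by_cases h : |η' x| ≤ m <;> simp [τ, h, hx])
        (by
          filter_upwards [hηη'] with x hx
          refine tendsto_const_nhds.congr' ?_
          filter_upwards [eventually_ge_atTop ⌈|η' x|⌉₊] with m hm
          have : |η' x| ≤ m := (Nat.le_ceil _).trans (by exact_mod_cast hm)
          simp [τ, this, hx])
      simpa using this
    rw [Metric.tendsto_atTop]
    intro ε hε
    obtain ⟨m, hm⟩ := (hτlim.eventually_lt_const (show 0 < ε / 3 by positivity)).exists
    obtain ⟨n₀, hn₀⟩ := Metric.tendsto_atTop.1 (hlim (τ m) (hτ2 m)) (ε / 3) (by positivity)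
    refine ⟨n₀, fun n hn => ?_⟩
    have h0 := hn₀ n hn
    have e1 : ∫ x, w₀ x * τ m x ∂ν = ∫ x, w x * τ m x ∂ν :=
      integral_congr_ae (by filter_upwards [hww] with x hx; rw [hx])
    have hsub {y : α → ℝ} (hy : AEStronglyMeasurable y ν) (hyb : ∀ x, |y x| ≤ 1) :
        |∫ x, y x * η x ∂ν - ∫ x, y x * τ m x ∂ν| < ε / 3 := by
      rw [← integral_sub (hmul hy hyb hη) (hmul hy hyb (hτi m))]
      simp_rw [← mul_sub]
      exact (hest hyb (hη.sub (hτi m))).trans_lt hm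
    have h1 := hsub ((hz (φ n)).mono_ac hac) (hb _)
    have h2 := hsub hwm.aestronglyMeasurable hwb
    rw [Real.dist_eq, e1] at h0
    rw [Real.dist_eq]
    rw [abs_lt] at *
    constructor <;> linarith [h0.1, h0.2, h1.1, h1.2, h2.1, h2.2]
  refine ⟨w, hwm, hwb, φ, hφ, fun f hf => ?_⟩
  have hη : Integrable (fun x => f x / ρ x) ν := by
    rw [hν, integrable_withDensity_iff_integrable_smul hρm]
    refine hf.congr (ae_of_all _ fun x => ?_)
    have : (ρ x : ℝ) ≠ 0 := by exact_mod_cast (hρ0 x).ne'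
    simp only [NNReal.smul_def, smul_eq_mul]
    field_simp
  have hconv (y : α → ℝ) : ∫ x, y x * (f x / ρ x) ∂ν = ∫ x, y x * f x ∂μ := by
    rw [hν, integral_withDensity_eq_integral_smul hρm]
    refine integral_congr_ae (ae_of_all _ fun x => ?_)
    have : (ρ x : ℝ) ≠ 0 := by exact_mod_cast (hρ0 x).ne'
    simp only [NNReal.smul_def, smul_eq_mul]
    field_simp
  simpa only [hconv] using htend _ hη

end WeakStar

end FracROF

namespace FracROF

/-! ### The singular kernel, its truncations, and integrability of difference quotients. -/

section Kernel

open Topology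

variable {N : ℕ} {s : ℝ}

/-- The kernel `|v|^{-(N+s)}`. -/
noncomputable def sKernel (s : ℝ) (v : EuclideanSpace ℝ (Fin N)) : ℝ := 1 / ‖v‖ ^ ((N : ℝ) + s)

/-- The bounded kernel `max(|v|, ε)^{-(N+s)}`. -/
noncomputable def truncKernel (s ε : ℝ) (v : EuclideanSpace ℝ (Fin N)) : ℝ :=
  1 / max ‖v‖ ε ^ ((N : ℝ) + s)

lemma sKernel_nonneg (v : EuclideanSpace ℝ (Fin N)) : 0 ≤ sKernel s v := by
  unfold sKernel; positivity

lemma measurable_sKernel : Measurable (sKernel (N := N) s) := by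
  unfold sKernel; fun_prop

lemma sKernel_neg (v : EuclideanSpace ℝ (Fin N)) : sKernel s (-v) = sKernel s v := by
  simp [sKernel]

lemma truncKernel_nonneg {ε : ℝ} (v : EuclideanSpace ℝ (Fin N)) : 0 ≤ truncKernel s ε v := by
  have : 0 ≤ max ‖v‖ ε := (norm_nonneg v).trans (le_max_left _ _)
  unfold truncKernel; positivity

lemma measurable_truncKernel {ε : ℝ} : Measurable (truncKernel (N := N) s ε) := by
  unfold truncKernel; fun_prop

lemma truncKernel_neg {ε : ℝ} (v : EuclideanSpace ℝ (Fin N)) :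
    truncKernel s ε (-v) = truncKernel s ε v := by
  simp [truncKernel]

lemma truncKernel_le_sKernel (hs0 : 0 < s) {ε : ℝ} {v : EuclideanSpace ℝ (Fin N)} (hv : v ≠ 0) :
    truncKernel s ε v ≤ sKernel s v := by
  have : 0 < ‖v‖ := norm_pos_iff.2 hv
  unfold truncKernel sKernel
  gcongr
  exact le_max_left _ _

lemma tendsto_truncKernel {v : EuclideanSpace ℝ (Fin N)} (hv : v ≠ 0) :
    Tendsto (fun n : ℕ => truncKernel s (1 / ((n : ℝ) + 1)) v) atTop (𝓝 (sKernel s v)) := by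
  refine tendsto_const_nhds.congr' ?_
  filter_upwards [(tendsto_one_div_add_atTop_nhds_zero_nat (𝕜 := ℝ)).eventually_lt_const
    (norm_pos_iff.2 hv)] with n hn
  rw [truncKernel, sKernel, max_eq_left hn.le]

lemma integrable_truncKernel (hs0 : 0 < s) {ε : ℝ} (hε : 0 < ε) :
    Integrable (truncKernel (N := N) s ε) := by
  have hd : (0 : ℝ) ≤ (N : ℝ) + s := by positivity
  have h1 : Integrable (fun v : EuclideanSpace ℝ (Fin N) => (1 + ‖v‖) ^ (-((N : ℝ) + s))) :=
    integrable_one_add_norm (by simpa using hs0)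
  refine (h1.const_mul ((1 / ε + 1) ^ ((N : ℝ) + s))).mono'
    measurable_truncKernel.aestronglyMeasurable (ae_of_all _ fun v => ?_)
  rw [Real.norm_of_nonneg (truncKernel_nonneg v)]
  have hm : 0 < max ‖v‖ ε := hε.trans_le (le_max_right _ _)
  have hle : 1 + ‖v‖ ≤ (1 / ε + 1) * max ‖v‖ ε := by
    have h2 : 1 ≤ 1 / ε * max ‖v‖ ε := by
      rw [div_mul_eq_mul_div, one_mul, le_div_iff₀ hε, one_mul]; exact le_max_right _ _
    linarith [le_max_left ‖v‖ ε]
  have h3 := Real.rpow_le_rpow (by positivity) hle hd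
  rw [Real.mul_rpow (by positivity) hm.le] at h3
  rw [truncKernel, Real.rpow_neg (by positivity), ← div_eq_mul_inv,
    div_le_div_iff₀ (by positivity) (by positivity), one_mul]
  exact h3

/-- In polar coordinates the integrand is y^(-s) on (0, 1], integrable as s < 1, and y^(-1-s)
beyond, integrable as s > 0. -/
lemma integrable_min_mul_sKernel (hN : 1 ≤ N) (hs0 : 0 < s) (hs1 : s < 1) :
    Integrable (fun v : EuclideanSpace ℝ (Fin N) => min ‖v‖ 1 * sKernel s v) := by
  have : Nonempty (Fin N) := ⟨⟨0, hN⟩⟩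
  have : Nontrivial (EuclideanSpace ℝ (Fin N)) := inferInstance
  refine (integrable_fun_norm_addHaar (volume : Measure (EuclideanSpace ℝ (Fin N)))
    (f := fun y => min y 1 * (1 / y ^ ((N : ℝ) + s)))).2 ?_
  have hpow {y : ℝ} (hy : 0 < y) : y ^ (N - 1) = y ^ ((N : ℝ) - 1) := by
    rw [← Real.rpow_natCast, Nat.cast_sub hN, Nat.cast_one]
  rw [← Ioc_union_Ioi_eq_Ioi (zero_le_one (α := ℝ))]
  refine IntegrableOn.union ?_ ?_
  · have h1 := (intervalIntegral.intervalIntegrable_rpow' (a := 0) (b := 1) (r := -s)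
      (by linarith)).1
    refine h1.congr_fun (fun y hy => ?_) measurableSet_Ioc
    have hy0 : 0 < y := hy.1
    simp only [finrank_euclideanSpace, Fintype.card_fin, smul_eq_mul]
    rw [min_eq_left hy.2, hpow hy0, one_div, ← Real.rpow_neg hy0.le]
    nth_rewrite 3 [← Real.rpow_one y]
    rw [← Real.rpow_add hy0, ← Real.rpow_add hy0]
    congr 1; ring
  · have h1 := integrableOn_Ioi_rpow_of_lt (a := -1 - s) (by linarith) zero_lt_one
    refine h1.congr_fun (fun y hy => ?_) measurableSet_Ioi
    have hy1 : 1 < y := hy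
    have hy0 : 0 < y := by linarith
    simp only [finrank_euclideanSpace, Fintype.card_fin, smul_eq_mul]
    rw [min_eq_right hy1.le, hpow hy0, one_mul, one_div, ← Real.rpow_neg hy0.le,
      ← Real.rpow_add hy0]
    congr 1; ring

/-- An integrable majorant of the nonlocal difference quotients of Lipschitz functions supported
in `S`. -/
noncomputable def majorant (s : ℝ) (S : Set (EuclideanSpace ℝ (Fin N)))
    (p : EuclideanSpace ℝ (Fin N) × EuclideanSpace ℝ (Fin N)) : ℝ :=
  (S.indicator 1 p.1 + S.indicator 1 p.2) * (min ‖p.1 - p.2‖ 1 * sKernel s (p.1 - p.2))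

lemma integrable_majorant (hN : 1 ≤ N) (hs0 : 0 < s) (hs1 : s < 1)
    {S : Set (EuclideanSpace ℝ (Fin N))} (hS : MeasurableSet S) (hS' : volume S ≠ ⊤) :
    Integrable (majorant s S) := by
  have hq := integrable_min_mul_sKernel hN hs0 hs1
  have hi : Integrable (S.indicator (1 : EuclideanSpace ℝ (Fin N) → ℝ)) :=
    (integrable_indicator_iff hS).2 (integrableOn_const hS')
  have h1 := integrable_mul_kernel (μ := volume) (z := fun _ => (1 : ℝ))
    aestronglyMeasurable_const (by simp) hq hi
  have h2 := h1.swap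
  refine (h1.add h2).congr (ae_of_all _ fun p => ?_)
  have e1 : sKernel s (p.2 - p.1) = sKernel s (p.1 - p.2) := by rw [← sKernel_neg, neg_sub]
  simp only [Pi.add_apply, Function.comp_apply, Prod.fst_swap, Prod.snd_swap, majorant, e1,
    norm_sub_rev p.2 p.1]
  ring

/-- The difference vanishes unless one of the points lies in S; it is at most L|x - y| for near
points and 2M for distant ones. -/
lemma abs_diff_mul_sKernel_le {φ : EuclideanSpace ℝ (Fin N) → ℝ} {L : ℝ≥0} {M : ℝ}
    {S : Set (EuclideanSpace ℝ (Fin N))} (hφ : LipschitzWith L φ) (hM : ∀ x, |φ x| ≤ M)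
    (hS : ∀ x, x ∉ S → φ x = 0) (p : EuclideanSpace ℝ (Fin N) × EuclideanSpace ℝ (Fin N)) :
    |(φ p.1 - φ p.2) * sKernel s (p.1 - p.2)| ≤ (L + 2 * M) * majorant s S p := by
  have hM0 : 0 ≤ M := (abs_nonneg _).trans (hM 0)
  have hK := sKernel_nonneg (s := s) (p.1 - p.2)
  have hmin : 0 ≤ min ‖p.1 - p.2‖ 1 := le_min (norm_nonneg _) zero_le_one
  rw [abs_mul, abs_of_nonneg hK, majorant, ← mul_assoc, ← mul_assoc]
  refine mul_le_mul_of_nonneg_right ?_ hK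
  have hdiff : |φ p.1 - φ p.2| ≤ (L + 2 * M) * min ‖p.1 - p.2‖ 1 := by
    rcases le_total ‖p.1 - p.2‖ 1 with h | h
    · rw [min_eq_left h]
      have := hφ.dist_le_mul p.1 p.2
      rw [Real.dist_eq, dist_eq_norm] at this
      nlinarith [norm_nonneg (p.1 - p.2)]
    · rw [min_eq_right h]
      have := (abs_sub (φ p.1) (φ p.2)).trans (add_le_add (hM _) (hM _))
      linarith [L.2]
  by_cases h1 : p.1 ∈ S <;> by_cases h2 : p.2 ∈ S <;> simp [h1, h2]
  · nlinarith [mul_nonneg (add_nonneg L.2 (mul_nonneg zero_le_two hM0)) hmin]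
  · simpa using hdiff
  · simpa using hdiff
  · simp [hS _ h1, hS _ h2]

lemma integrable_diff_mul_sKernel (hN : 1 ≤ N) (hs0 : 0 < s) (hs1 : s < 1)
    {φ : EuclideanSpace ℝ (Fin N) → ℝ} {L : ℝ≥0} (hφ : LipschitzWith L φ)
    (hc : HasCompactSupport φ) :
    Integrable (fun p : EuclideanSpace ℝ (Fin N) × EuclideanSpace ℝ (Fin N) =>
      (φ p.1 - φ p.2) * sKernel s (p.1 - p.2)) := by
  obtain ⟨M, hM⟩ := hc.exists_bound_of_continuous hφ.continuous
  have hcont := hφ.continuous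
  refine ((integrable_majorant hN hs0 hs1 hc.isCompact.measurableSet
    hc.isCompact.measure_lt_top.ne).const_mul (L + 2 * M)).mono' ?_ (ae_of_all _ fun p =>
      abs_diff_mul_sKernel_le hφ (by simpa using hM) (fun x hx => image_eq_zero_of_notMem_tsupport hx) p)
  have := measurable_sKernel (N := N) (s := s)
  exact Measurable.aestronglyMeasurable (by fun_prop)

lemma cs_pos (hs1 : s < 1) : 0 < cs N s := by
  refine div_pos (by linarith) (ENNReal.toReal_pos ?_ measure_ball_lt_top.ne)
  exact (Metric.measure_ball_pos volume _ one_pos).ne'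

lemma nonlocalGrad_eq (φ : EuclideanSpace ℝ (Fin N) → ℝ)
    (p : EuclideanSpace ℝ (Fin N) × EuclideanSpace ℝ (Fin N)) :
    nonlocalGrad s φ p = cs N s / 2 * ((φ p.1 - φ p.2) * sKernel s (p.1 - p.2)) := by
  simp [nonlocalGrad, sKernel, div_eq_mul_inv]

lemma nonlocalDiv_eq (w : EuclideanSpace ℝ (Fin N) × EuclideanSpace ℝ (Fin N) → ℝ)
    (φ : EuclideanSpace ℝ (Fin N) → ℝ) :
    nonlocalDiv s w φ =
      -(cs N s / 2 * ∫ p, w p * ((φ p.1 - φ p.2) * sKernel s (p.1 - p.2))) := by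
  rw [nonlocalDiv, ← integral_const_mul]
  congr 2
  ext p
  rw [nonlocalGrad_eq]
  ring

lemma ae_fst_ne_snd (hN : 1 ≤ N) :
    ∀ᵐ p : EuclideanSpace ℝ (Fin N) × EuclideanSpace ℝ (Fin N), p.1 - p.2 ≠ 0 := by
  have : Nonempty (Fin N) := ⟨⟨0, hN⟩⟩
  have : Nontrivial (EuclideanSpace ℝ (Fin N)) := inferInstance
  rw [Measure.volume_eq_prod, Measure.ae_prod_iff_ae_ae]
  · refine ae_of_all _ fun x => ?_
    filter_upwards [compl_mem_ae_iff.2 (measure_singleton (μ := volume) x)] with y hy h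
    exact hy (sub_eq_zero.1 h).symm
  · exact (measurableSet_eq_fun (by fun_prop) measurable_const).compl

end Kernel

end FracROF

namespace FracROF

/-! ### Lipschitz approximation of the sign. -/

section ClampSign

open Topology

/-- The Lipschitz approximation `clamp ((n + 1) r)` of the sign function. -/
noncomputable def clampSign (n : ℕ) (r : ℝ) : ℝ := max (-1) (min 1 (((n : ℝ) + 1) * r))

lemma clampSign_monotone (n : ℕ) : Monotone (clampSign n) := fun a b hab => by
  unfold clampSign
  gcongr

lemma clampSign_lipschitz (n : ℕ) : LipschitzWith (n + 1 : ℝ≥0) (clampSign n) := by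
  have h : LipschitzWith (n + 1 : ℝ≥0) fun r : ℝ => ((n : ℝ) + 1) * r :=
    LipschitzWith.of_dist_le_mul fun a b => by
      rw [Real.dist_eq, Real.dist_eq, ← mul_sub, abs_mul, abs_of_nonneg (by positivity)]
      simp
  exact (h.const_min 1).const_max (-1)

lemma abs_clampSign_le (n : ℕ) (r : ℝ) : |clampSign n r| ≤ 1 :=
  abs_le.2 ⟨le_max_left _ _, max_le (by norm_num) (min_le_left _ _)⟩

lemma clampSign_neg (n : ℕ) (r : ℝ) : clampSign n (-r) = -clampSign n r := by
  unfold clampSign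
  rw [mul_neg]
  grind

/-- The argument is allowed to vary with n because the approximate solutions do; away from r = 0 the
clamp is eventually saturated. -/
lemma tendsto_clampSign {a : ℕ → ℝ} {r : ℝ} {φ : ℕ → ℕ} (hφ : StrictMono φ)
    (ha : Tendsto a atTop (𝓝 r)) (hr : r ≠ 0) :
    Tendsto (fun n => clampSign (φ n) (a n)) atTop (𝓝 (Real.sign r)) := by
  have hpos {a : ℕ → ℝ} {r : ℝ} (ha : Tendsto a atTop (𝓝 r)) (hr : 0 < r) :
      Tendsto (fun n => clampSign (φ n) (a n)) atTop (𝓝 1) := by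
    have h1 : Tendsto (fun n => ((φ n : ℝ) + 1) * a n) atTop atTop :=
      (tendsto_atTop_add_const_right _ _
        (tendsto_natCast_atTop_atTop.comp hφ.tendsto_atTop)).atTop_mul_pos hr ha
    refine tendsto_const_nhds.congr' ?_
    filter_upwards [h1.eventually_ge_atTop 1] with n hn
    rw [clampSign, min_eq_left hn]
    norm_num
  rcases hr.lt_or_gt with h | h
  · rw [Real.sign_of_neg h]
    simpa [clampSign_neg] using (hpos ha.neg (neg_pos.2 h)).neg
  · rw [Real.sign_of_pos h]
    exact hpos ha h

end ClampSign

/-! ### Pointwise compactness of equi-Lipschitz sequences. -/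

section Compactness

open Topology

/-- A pointwise bounded sequence of equi-Lipschitz functions on a separable space has a pointwise
convergent subsequence. -/
lemma exists_subseq_tendsto_of_lipschitz {X : Type*} [PseudoMetricSpace X]
    [TopologicalSpace.SeparableSpace X] [Nonempty X] {K : ℝ≥0} (f : ℕ → X → ℝ)
    (hf : ∀ n, LipschitzWith K (f n)) (a b : X → ℝ) (hab : ∀ n x, f n x ∈ Icc (a x) (b x)) :
    ∃ u : X → ℝ, ∃ φ : ℕ → ℕ, StrictMono φ ∧ ∀ x,
      Tendsto (fun n => f (φ n) x) atTop (𝓝 (u x)) := by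
  let q := TopologicalSpace.denseSeq X
  -- Sequential compactness of a countable product of intervals replaces the diagonal argument on a
  -- dense sequence; equicontinuity then gives the Cauchy property at every point.
  obtain ⟨c, -, φ, hφ, hc⟩ := (isCompact_univ_pi fun i : ℕ =>
    isCompact_Icc (a := a (q i)) (b := b (q i))).tendsto_subseq
    (x := fun n i => f n (q i)) fun n i _ => hab n (q i)
  rw [tendsto_pi_nhds] at hc
  have hcau (x : X) : CauchySeq fun n => f (φ n) x := by
    rw [Metric.cauchySeq_iff]
    intro ε hε
    have hK : 0 < ε / (4 * (K + 1)) := by positivity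
    obtain ⟨i, hi⟩ := (TopologicalSpace.denseRange_denseSeq X).exists_dist_lt x hK
    have hKi : K * dist x (q i) ≤ ε / 4 := by
      have h1 : (K : ℝ) * dist x (q i) ≤ (K + 1) * (ε / (4 * (K + 1))) := by
        gcongr
        linarith
      refine h1.trans (le_of_eq ?_)
      field_simp
    obtain ⟨n₀, hn₀⟩ := Metric.cauchySeq_iff.1 (hc i).cauchySeq (ε / 2) (by positivity)
    refine ⟨n₀, fun m hm n hn => ?_⟩
    have h1 := hn₀ m hm n hn
    have h2 := (hf (φ m)).dist_le_mul x (q i)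
    have h3 := (hf (φ n)).dist_le_mul (q i) x
    rw [dist_comm (q i)] at h3
    calc dist (f (φ m) x) (f (φ n) x) ≤ _ := dist_triangle4 _ (f (φ m) (q i)) (f (φ n) (q i)) _
      _ < ε := by simp only [Function.comp_apply] at h1; linarith
  choose u hu using fun x => cauchySeq_tendsto_of_complete (hcau x)
  exact ⟨u, φ, hφ, hu⟩

end Compactness

/-! ### Passage to the limit in the regularized equations. -/

section Existence

open Topology

variable {N : ℕ} {s : ℝ}

/-- The tent function centred at `x₀`. -/
noncomputable def tent (x₀ x : EuclideanSpace ℝ (Fin N)) : ℝ := max 0 (1 - ‖x - x₀‖)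

lemma tent_nonneg (x₀ x : EuclideanSpace ℝ (Fin N)) : 0 ≤ tent x₀ x := le_max_left _ _

lemma tent_le_one (x₀ x : EuclideanSpace ℝ (Fin N)) : tent x₀ x ≤ 1 :=
  max_le zero_le_one (by linarith [norm_nonneg (x - x₀)])

lemma tent_lipschitz (x₀ : EuclideanSpace ℝ (Fin N)) : LipschitzWith 1 (tent x₀) := by
  refine LipschitzWith.const_max (LipschitzWith.of_dist_le_mul fun x y => ?_) 0
  rw [Real.dist_eq, sub_sub_sub_cancel_left, NNReal.coe_one, one_mul, dist_comm, dist_eq_norm]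
  simpa using abs_norm_sub_norm_le (y - x₀) (x - x₀)

lemma tent_eq_zero {x₀ x : EuclideanSpace ℝ (Fin N)} (hx : x ∉ Metric.closedBall x₀ 1) :
    tent x₀ x = 0 := by
  rw [Metric.mem_closedBall, dist_eq_norm, not_le] at hx
  exact max_eq_left (by linarith)

lemma tent_hasCompactSupport (x₀ : EuclideanSpace ℝ (Fin N)) : HasCompactSupport (tent x₀) :=
  HasCompactSupport.intro (isCompact_closedBall x₀ 1) fun _ hx => tent_eq_zero hx

lemma integral_tent (x₀ : EuclideanSpace ℝ (Fin N)) : ∫ x, tent x₀ x =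
    ∫ x, tent (0 : EuclideanSpace ℝ (Fin N)) x := by
  rw [← integral_sub_right_eq_self (tent 0) x₀]
  simp [tent]

lemma integral_tent_pos : 0 < ∫ x, tent (0 : EuclideanSpace ℝ (Fin N)) x := by
  refine (tent_lipschitz 0).continuous.integral_pos_of_hasCompactSupport_nonneg_nonzero
    (tent_hasCompactSupport 0) (tent_nonneg 0) (x := 0) ?_
  simp [tent]

lemma integral_majorant_ball (x₀ : EuclideanSpace ℝ (Fin N)) :
    ∫ p, majorant s (Metric.closedBall x₀ 1) p =
      ∫ p, majorant s (Metric.closedBall (0 : EuclideanSpace ℝ (Fin N)) 1) p := by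
  have : Measure.IsAddRightInvariant
      (volume : Measure (EuclideanSpace ℝ (Fin N) × EuclideanSpace ℝ (Fin N))) := by
    rw [Measure.volume_eq_prod]; infer_instance
  rw [← integral_sub_right_eq_self (majorant s (Metric.closedBall 0 1)) (x₀, x₀)]
  simp [majorant, indicator, dist_eq_norm]

/-- A K-Lipschitz function differs from d(x₀) by at most K on the support of the tent, so its
weighted mean there controls d(x₀). -/
lemma abs_integral_le_of_lipschitz {d : EuclideanSpace ℝ (Fin N) → ℝ} {K : ℝ≥0} {A : ℝ}
    (hd : LipschitzWith K d) {x₀ : EuclideanSpace ℝ (Fin N)}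
    (hA : |∫ x, d x * tent x₀ x| ≤ A) :
    |d x₀| ≤ A / (∫ x, tent (0 : EuclideanSpace ℝ (Fin N)) x) + K := by
  have hI := integral_tent_pos (N := N)
  set I := ∫ x, tent (0 : EuclideanSpace ℝ (Fin N)) x
  have hti : Integrable (tent x₀) :=
    (tent_lipschitz x₀).continuous.integrable_of_hasCompactSupport (tent_hasCompactSupport x₀)
  have hdi : Integrable (fun x => d x * tent x₀ x) :=
    (hd.continuous.mul (tent_lipschitz x₀).continuous).integrable_of_hasCompactSupport
      (tent_hasCompactSupport x₀).mul_left
  have h1 : |∫ x, (d x₀ * tent x₀ x - d x * tent x₀ x)| ≤ ∫ x, K * tent x₀ x := by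
    rw [← Real.norm_eq_abs]
    refine norm_integral_le_of_norm_le (hti.const_mul _) (ae_of_all _ fun x => ?_)
    rw [← sub_mul, norm_mul, Real.norm_of_nonneg (tent_nonneg x₀ x), ← dist_eq_norm]
    by_cases hx : x ∈ Metric.closedBall x₀ 1
    · refine mul_le_mul_of_nonneg_right ((hd.dist_le_mul _ _).trans ?_) (tent_nonneg x₀ x)
      rw [dist_comm]
      exact mul_le_of_le_one_right K.2 hx
    · simp [tent_eq_zero hx]
  rw [integral_sub (hti.const_mul _) hdi, integral_const_mul, integral_const_mul,
    integral_tent] at h1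
  have h2 : |d x₀ * I| ≤ A + K * I := by
    have := abs_add_le (d x₀ * I - ∫ x, d x * tent x₀ x) (∫ x, d x * tent x₀ x)
    rw [sub_add_cancel] at this
    linarith
  rw [abs_mul, abs_of_pos hI] at h2
  rw [div_add' _ _ _ hI.ne', le_div_iff₀ hI]
  exact h2

/-- The weak equation `h div_s z = u - g`, tested against every integrable function of finite
Gagliardo seminorm. -/
def WeakEquation (s h : ℝ) (g u : EuclideanSpace ℝ (Fin N) → ℝ)
    (z : EuclideanSpace ℝ (Fin N) × EuclideanSpace ℝ (Fin N) → ℝ) : Prop :=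
  ∀ f : EuclideanSpace ℝ (Fin N) → ℝ, Integrable f →
    Integrable (fun p : EuclideanSpace ℝ (Fin N) × EuclideanSpace ℝ (Fin N) =>
      (f p.1 - f p.2) * sKernel s (p.1 - p.2)) →
    ∫ x, (u x - g x) * f x =
      -(h * cs N s / 2) * ∫ p, z p * ((f p.1 - f p.2) * sKernel s (p.1 - p.2))

/-- For a Lipschitz datum, the equation holds weakly against all integrable functions of finite
Gagliardo seminorm. -/
theorem exists_weak_solution (hN : 1 ≤ N) (hs0 : 0 < s) (hs1 : s < 1) {h : ℝ} (hh : 0 < h)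
    {g : EuclideanSpace ℝ (Fin N) → ℝ} {K : ℝ≥0} (hg : LipschitzWith K g) :
    ∃ (u : EuclideanSpace ℝ (Fin N) → ℝ)
      (z : EuclideanSpace ℝ (Fin N) × EuclideanSpace ℝ (Fin N) → ℝ),
      LipschitzWith K u ∧ (∃ C, ∀ x, |u x - g x| ≤ C) ∧ Measurable z ∧ (∀ p, |z p| ≤ 1) ∧
      (∀ p, z p * (u p.1 - u p.2) = |u p.1 - u p.2|) ∧
      WeakEquation s h g u z := by
  have hc : 0 < h * cs N s := mul_pos hh (cs_pos hs1)
  let ε (n : ℕ) : ℝ := 1 / ((n : ℝ) + 1)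
  have hε (n : ℕ) : 0 < ε n := by positivity
  let k (n : ℕ) (v : EuclideanSpace ℝ (Fin N)) : ℝ := h * cs N s * truncKernel s (ε n) v
  have hk (n : ℕ) : Integrable (k n) := (integrable_truncKernel hs0 (hε n)).const_mul _
  choose U hU hUeq using fun n : ℕ => exists_regularized_solution (clampSign_monotone n)
    (clampSign_lipschitz n) (abs_clampSign_le n) (hk n)
    (fun v => mul_nonneg hc.le (truncKernel_nonneg v)) hg
  let Z (n : ℕ) (p : EuclideanSpace ℝ (Fin N) × EuclideanSpace ℝ (Fin N)) : ℝ :=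
    clampSign n (U n p.1 - U n p.2)
  have hZc (n : ℕ) : Continuous (Z n) := by
    have h1 := (hU n).continuous
    have h2 := (clampSign_lipschitz n).continuous
    fun_prop
  have hZb (n : ℕ) (p) : |Z n p| ≤ 1 := abs_clampSign_le _ _
  have hweak (n : ℕ) {f : EuclideanSpace ℝ (Fin N) → ℝ} (hf : Integrable f) :
      ∫ x, (U n x - g x) * f x = -(h * cs N s / 2) *
        ∫ p, Z n p * ((f p.1 - f p.2) * truncKernel s (ε n) (p.1 - p.2)) := by
    have := regularized_weak_form (μ := volume) (clampSign_lipschitz n).continuous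
      (clampSign_neg n) (abs_clampSign_le n) (hk n) (fun v => by simp only [k, truncKernel_neg])
      (hU n).continuous (hUeq n) hf
    rw [this, ← Measure.volume_eq_prod, ← integral_const_mul, ← integral_const_mul]
    congr 1
    ext p
    simp only [Z, k]
    ring
  have hcmp (n : ℕ) (f : EuclideanSpace ℝ (Fin N) → ℝ) :
      ∀ᵐ p : EuclideanSpace ℝ (Fin N) × EuclideanSpace ℝ (Fin N),
        |(f p.1 - f p.2) * truncKernel s (ε n) (p.1 - p.2)| ≤
          |(f p.1 - f p.2) * sKernel s (p.1 - p.2)| := by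
    filter_upwards [ae_fst_ne_snd hN] with p hp
    rw [abs_mul, abs_mul, abs_of_nonneg (truncKernel_nonneg _), abs_of_nonneg (sKernel_nonneg _)]
    exact mul_le_mul_of_nonneg_left (truncKernel_le_sKernel hs0 hp) (abs_nonneg _)
  obtain ⟨C, hC⟩ : ∃ C, ∀ n x, |U n x - g x| ≤ C := by
    -- The tent is 1-Lipschitz and bounded by 1, hence the factor 1 + 2; K + K is a Lipschitz
    -- constant of the difference `U n - g`. By translation invariance nothing depends on the
    -- centre.
    refine ⟨(h * cs N s / 2) *
      ((1 + 2) * ∫ p, majorant s (Metric.closedBall (0 : EuclideanSpace ℝ (Fin N)) 1) p) /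
        (∫ x, tent (0 : EuclideanSpace ℝ (Fin N)) x) + (K + K : ℝ≥0), fun n x => ?_⟩
    refine abs_integral_le_of_lipschitz (d := fun x => U n x - g x) ((hU n).sub hg) ?_
    rw [hweak n ((tent_lipschitz x).continuous.integrable_of_hasCompactSupport
      (tent_hasCompactSupport x)), abs_mul, abs_neg, abs_of_pos (by positivity)]
    refine mul_le_mul_of_nonneg_left ?_ (by positivity)
    rw [← integral_majorant_ball x, ← integral_const_mul, ← Real.norm_eq_abs]
    refine norm_integral_le_of_norm_le ((integrable_majorant hN hs0 hs1
      Metric.isClosed_closedBall.measurableSet measure_closedBall_lt_top.ne).const_mul _) ?_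
    filter_upwards [hcmp n (tent x)] with p hp
    rw [norm_mul, Real.norm_eq_abs, Real.norm_eq_abs]
    refine (mul_le_of_le_one_left (abs_nonneg _) (hZb n p)).trans (hp.trans ?_)
    simpa using abs_diff_mul_sKernel_le (s := s) (M := 1) (tent_lipschitz x)
      (fun y => by rw [abs_of_nonneg (tent_nonneg x y)]; exact tent_le_one x y)
      (fun y hy => tent_eq_zero hy) p
  obtain ⟨u, φ₁, hφ₁, hu₁⟩ := exists_subseq_tendsto_of_lipschitz U hU (fun x => g x - C)
    (fun x => g x + C) fun n x => by
      have := abs_le.1 (hC n x)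
      constructor <;> linarith
  have huK : LipschitzWith K u := LipschitzWith.of_dist_le_mul fun x y =>
    le_of_tendsto ((hu₁ x).dist (hu₁ y)) (Eventually.of_forall fun n => (hU _).dist_le_mul x y)
  have huC (x) : |u x - g x| ≤ C :=
    le_of_tendsto ((hu₁ x).sub_const _).abs (Eventually.of_forall fun n => hC _ x)
  obtain ⟨w, hwm, hwb, φ₂, hφ₂, hw⟩ := exists_weakStar_subseq volume (fun n => Z (φ₁ n))
    (fun n => (hZc _).aestronglyMeasurable) (fun n => hZb _)
  let φ := φ₁ ∘ φ₂
  have hφ : StrictMono φ := hφ₁.comp hφ₂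
  have hu (x) : Tendsto (fun n => U (φ n) x) atTop (𝓝 (u x)) := (hu₁ x).comp hφ₂.tendsto_atTop
  let A : Set (EuclideanSpace ℝ (Fin N) × EuclideanSpace ℝ (Fin N)) := {p | u p.1 = u p.2}
  have hA : MeasurableSet A := by
    have := huK.continuous
    exact (isClosed_eq (by fun_prop) (by fun_prop)).measurableSet
  classical
  -- The weak-* limit is kept only where u(x) = u(y), where it is unconstrained by the calibration
  -- identity; elsewhere the exact sign is imposed.
  let z : EuclideanSpace ℝ (Fin N) × EuclideanSpace ℝ (Fin N) → ℝ :=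
    A.piecewise w fun p => Real.sign (u p.1 - u p.2)
  have hsignm : Measurable Real.sign :=
    Measurable.ite measurableSet_Iio measurable_const
      (Measurable.ite measurableSet_Ioi measurable_const measurable_const)
  have hzm : Measurable z := by
    have := huK.continuous.measurable
    exact hwm.piecewise hA (hsignm.comp (by fun_prop))
  have hzb (p) : |z p| ≤ 1 := by
    by_cases hp : p ∈ A
    · simpa [z, hp] using hwb p
    · simp only [z, piecewise_eq_of_notMem _ _ _ hp]
      rcases Real.sign_apply_eq (u p.1 - u p.2) with h | h | h <;> simp [h]
  -- On A this is weak-* convergence tested with the indicator of A times f; off A the clamps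
  -- converge pointwise to the sign and dominated convergence applies.
  have hzlim {f : EuclideanSpace ℝ (Fin N) × EuclideanSpace ℝ (Fin N) → ℝ} (hf : Integrable f) :
      Tendsto (fun n => ∫ p, Z (φ n) p * f p) atTop (𝓝 (∫ p, z p * f p)) := by
    have hint {y : EuclideanSpace ℝ (Fin N) × EuclideanSpace ℝ (Fin N) → ℝ} (hy : Measurable y)
        (hb : ∀ p, |y p| ≤ 1) : Integrable fun p => y p * f p :=
      hf.bdd_mul (c := 1) hy.aestronglyMeasurable (ae_of_all _ fun p => by simpa using hb p)
    have hsplit {y : EuclideanSpace ℝ (Fin N) × EuclideanSpace ℝ (Fin N) → ℝ} (hy : Measurable y)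
        (hb : ∀ p, |y p| ≤ 1) : ∫ p, y p * f p =
          (∫ p in A, y p * f p) + ∫ p in Aᶜ, y p * f p :=
      (integral_add_compl hA (hint hy hb)).symm
    simp only [hsplit (hZc _).measurable (hZb _), hsplit hzm hzb]
    refine Tendsto.add ?_ ?_
    · have h1 := hw (A.indicator f) (hf.indicator hA)
      simp only [← indicator_mul_right, integral_indicator hA] at h1
      rw [setIntegral_congr_fun hA (g := fun p => w p * f p) fun p hp => by simp [z, hp]]
      exact h1
    · refine tendsto_integral_of_dominated_convergence (fun p => |f p|)
        (fun n => (hint (hZc _).measurable (hZb _)).1.restrict) hf.abs.integrableOn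
        (fun n => ae_of_all _ fun p => ?_) ?_
      · rw [norm_mul, Real.norm_eq_abs, Real.norm_eq_abs]
        exact mul_le_of_le_one_left (abs_nonneg _) (hZb _ p)
      · filter_upwards [ae_restrict_mem hA.compl] with p hp
        simp only [z, piecewise_eq_of_notMem _ _ _ hp]
        exact (tendsto_clampSign hφ ((hu p.1).sub (hu p.2)) (sub_ne_zero.2 hp)).mul_const _
  refine ⟨u, z, huK, ⟨C, huC⟩, hzm, hzb, fun p => ?_, fun f hf hD => ?_⟩
  · by_cases hp : p ∈ A
    · simp [show u p.1 = u p.2 from hp]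
    · simp only [z, piecewise_eq_of_notMem _ _ _ hp]
      rcases lt_trichotomy (u p.1 - u p.2) 0 with h | h | h
      · rw [Real.sign_of_neg h, abs_of_neg h]; ring
      · simp [h]
      · rw [Real.sign_of_pos h, abs_of_pos h]; ring
  · have hL : Tendsto (fun n => ∫ x, (U (φ n) x - g x) * f x) atTop
        (𝓝 (∫ x, (u x - g x) * f x)) := by
      refine tendsto_integral_of_dominated_convergence (fun x => C * |f x|) (fun n => ?_)
        (hf.abs.const_mul C) (fun n => ae_of_all _ fun x => ?_)
        (ae_of_all _ fun x => ((hu x).sub_const _).mul_const _)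
      · exact ((hU _).continuous.sub hg.continuous).aestronglyMeasurable.mul hf.1
      · rw [norm_mul, Real.norm_eq_abs, Real.norm_eq_abs]
        exact mul_le_mul_of_nonneg_right (hC _ x) (abs_nonneg _)
    have hfm : AEStronglyMeasurable (fun p : EuclideanSpace ℝ (Fin N) × EuclideanSpace ℝ (Fin N) =>
        f p.1 - f p.2) := hf.1.comp_fst.sub hf.1.comp_snd
    have hTm (n : ℕ) : AEStronglyMeasurable
        (fun p : EuclideanSpace ℝ (Fin N) × EuclideanSpace ℝ (Fin N) =>
          (f p.1 - f p.2) * truncKernel s (ε n) (p.1 - p.2)) := by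
      have := measurable_truncKernel (N := N) (s := s) (ε := ε n)
      exact hfm.mul (Measurable.aestronglyMeasurable (by fun_prop))
    have hTi (n : ℕ) : Integrable (fun p : EuclideanSpace ℝ (Fin N) × EuclideanSpace ℝ (Fin N) =>
          (f p.1 - f p.2) * truncKernel s (ε n) (p.1 - p.2)) :=
      hD.mono (hTm n) (hcmp n f)
    -- Weak-* convergence requires a fixed test function, so the kernel error is split off; it
    -- vanishes in L¹ by domination.
    have hrest : Tendsto (fun n => ∫ p, Z (φ n) p *
        ((f p.1 - f p.2) * truncKernel s (ε (φ n)) (p.1 - p.2) -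
          (f p.1 - f p.2) * sKernel s (p.1 - p.2))) atTop (𝓝 0) := by
      have := tendsto_integral_of_dominated_convergence (μ := volume)
        (F := fun n (p : EuclideanSpace ℝ (Fin N) × EuclideanSpace ℝ (Fin N)) => Z (φ n) p *
          ((f p.1 - f p.2) * truncKernel s (ε (φ n)) (p.1 - p.2) -
            (f p.1 - f p.2) * sKernel s (p.1 - p.2))) (f := fun _ => 0)
        (fun p => 2 * |(f p.1 - f p.2) * sKernel s (p.1 - p.2)|)
        (fun n => (hZc _).aestronglyMeasurable.mul ((hTm _).sub hD.1)) (hD.abs.const_mul 2)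
        (fun n => by
          filter_upwards [hcmp (φ n) f] with p hp
          rw [norm_mul, Real.norm_eq_abs, Real.norm_eq_abs]
          refine (mul_le_of_le_one_left (abs_nonneg _) (hZb _ p)).trans ((abs_sub _ _).trans ?_)
          linarith)
        (by
          filter_upwards [ae_fst_ne_snd hN] with p hp
          have h1 := (tendsto_truncKernel (s := s) hp).comp hφ.tendsto_atTop
          have h2 := (h1.const_mul (f p.1 - f p.2)).sub_const
            ((f p.1 - f p.2) * sKernel s (p.1 - p.2))
          rw [sub_self] at h2
          have h3 := h2.norm
          rw [norm_zero] at h3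
          refine squeeze_zero_norm (fun n => ?_) h3
          rw [norm_mul]
          exact mul_le_of_le_one_left (norm_nonneg _) (hZb _ p))
      simpa using this
    have hR := (hzlim hD).add hrest
    rw [add_zero] at hR
    refine tendsto_nhds_unique hL ((hR.const_mul (-(h * cs N s / 2))).congr fun n => ?_)
    rw [hweak _ hf, ← integral_add]
    · simp_rw [← mul_add, add_sub_cancel]
    · exact hD.bdd_mul (c := 1) (hZc _).aestronglyMeasurable
        (ae_of_all _ fun p => by simpa using hZb _ p)
    · exact ((hTi _).sub hD).bdd_mul (c := 1) (hZc _).aestronglyMeasurable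
        (ae_of_all _ fun p => by simpa using hZb _ p)

end Existence

end FracROF

namespace FracROF

/-! ### The comparison principle. -/

section Comparison

open Topology Convolution

variable {N : ℕ} {s : ℝ}

/-- A compactly supported Lipschitz function is a pointwise limit of test functions with the same
Lipschitz constant, a common bound and a common bounded support. -/
lemma exists_smooth_approx {φ : EuclideanSpace ℝ (Fin N) → ℝ} {L : ℝ≥0}
    (hφ : LipschitzWith L φ) (hc : HasCompactSupport φ) :
    ∃ (φ' : ℕ → EuclideanSpace ℝ (Fin N) → ℝ) (M : ℝ) (S : Set (EuclideanSpace ℝ (Fin N))),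
      IsCompact S ∧ (∀ n, ContDiff ℝ ∞ (φ' n)) ∧ (∀ n, LipschitzWith L (φ' n)) ∧
      (∀ n x, |φ' n x| ≤ M) ∧ (∀ n x, x ∉ S → φ' n x = 0) ∧
      ∀ x, Tendsto (fun n => φ' n x) atTop (𝓝 (φ x)) := by
  obtain ⟨M, hM⟩ := hc.exists_bound_of_continuous hφ.continuous
  -- Mollification at scale 1/(n + 1) ≤ 1 does not increase the Lipschitz constant and keeps all
  -- supports in the closed 1-neighbourhood of the support of φ.
  let ρ (n : ℕ) : ContDiffBump (0 : EuclideanSpace ℝ (Fin N)) :=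
    ⟨1 / ((n : ℝ) + 1) / 2, 1 / ((n : ℝ) + 1), by positivity, half_lt_self (by positivity)⟩
  have hρ (n : ℕ) : (ρ n).rOut = 1 / ((n : ℝ) + 1) := rfl
  have hρ1 (n : ℕ) : (ρ n).rOut ≤ 1 := by
    rw [hρ, div_le_one (by positivity)]; linarith [(Nat.cast_nonneg n : (0 : ℝ) ≤ n)]
  let φ' (n : ℕ) : EuclideanSpace ℝ (Fin N) → ℝ :=
    (ρ n).normed volume ⋆[ContinuousLinearMap.lsmul ℝ ℝ, volume] φ
  have hdist (n : ℕ) (x : EuclideanSpace ℝ (Fin N)) : dist (φ' n x) (φ x) ≤ L * (ρ n).rOut :=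
    (ρ n).dist_normed_convolution_le hφ.continuous.aestronglyMeasurable fun y hy =>
      (hφ.dist_le_mul y x).trans (mul_le_mul_of_nonneg_left (le_of_lt hy) L.2)
  refine ⟨φ', M + L, Metric.cthickening 1 (tsupport φ), hc.isCompact.cthickening, fun n => ?_,
    fun n => ?_, fun n x => ?_, fun n x hx => ?_, fun x => ?_⟩
  · exact (ρ n).hasCompactSupport_normed.contDiff_convolution_left _ (ρ n).contDiff_normed
      hφ.continuous.locallyIntegrable
  · have hi (x : EuclideanSpace ℝ (Fin N)) :
        Integrable (fun t => (ρ n).normed volume t * φ (x - t)) := by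
      have h1 := hφ.continuous
      have h2 := (ρ n).contDiff_normed (μ := volume) (n := 0) |>.continuous
      exact (h2.mul (by fun_prop)).integrable_of_hasCompactSupport
        (ρ n).hasCompactSupport_normed.mul_right
    refine LipschitzWith.of_dist_le_mul fun x y => ?_
    simp only [φ', convolution_def, ContinuousLinearMap.lsmul_apply, smul_eq_mul]
    rw [dist_eq_norm, ← integral_sub (hi x) (hi y)]
    have h3 := norm_integral_le_of_norm_le (μ := volume)
      (f := fun t => (ρ n).normed volume t * φ (x - t) - (ρ n).normed volume t * φ (y - t))
      (g := fun t => (ρ n).normed volume t * (L * dist x y))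
      ((ρ n).integrable_normed.mul_const _) (ae_of_all _ fun t => by
        rw [← mul_sub, norm_mul, Real.norm_of_nonneg ((ρ n).nonneg_normed t), ← dist_eq_norm]
        refine mul_le_mul_of_nonneg_left ?_ ((ρ n).nonneg_normed t)
        simpa using hφ.dist_le_mul (x - t) (y - t))
    rwa [integral_mul_const, (ρ n).integral_normed, one_mul] at h3
  · have h1 := abs_add_le (φ' n x - φ x) (φ x)
    have h2 := hdist n x
    have h3 := hM x
    rw [Real.dist_eq] at h2
    rw [Real.norm_eq_abs] at h3
    rw [sub_add_cancel] at h1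
    nlinarith [hρ1 n, L.2]
  · have h0 (y) (hy : dist y x < 1) : φ y = 0 := by
      refine image_eq_zero_of_notMem_tsupport fun hy' => hx ?_
      exact Metric.mem_cthickening_of_dist_le x y 1 _ hy' (by rw [dist_comm]; exact hy.le)
    have := (ρ n).dist_normed_convolution_le (μ := volume) (x₀ := x) (ε := 0)
      hφ.continuous.aestronglyMeasurable fun y hy => by
        rw [h0 y ((Metric.mem_ball.1 hy).trans_le (hρ1 n)), h0 x (by simp), dist_self]
    rw [h0 x (by simp)] at this
    exact dist_le_zero.1 this
  · rw [tendsto_iff_dist_tendsto_zero]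
    refine squeeze_zero (fun _ => dist_nonneg) (fun n => hdist n x) ?_
    simpa [hρ] using (tendsto_one_div_add_atTop_nhds_zero_nat (𝕜 := ℝ)).const_mul (L : ℝ)

lemma IsCalibration.ae_abs_le {u : EuclideanSpace ℝ (Fin N) → ℝ}
    {z : EuclideanSpace ℝ (Fin N) × EuclideanSpace ℝ (Fin N) → ℝ} (hz : IsCalibration u z) :
    ∀ᵐ p, |z p| ≤ 1 := by
  have h := hz.2.1
  rw [eLpNorm_exponent_top] at h
  filter_upwards [ae_le_eLpNormEssSup (f := z) (μ := volume)] with p hp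
  have := hp.trans h
  rwa [← Real.norm_eq_abs, ← toReal_enorm, ← ENNReal.toReal_one,
    ENNReal.toReal_le_toReal (by simp) (by simp)]

/-- Extends the distributional equation from smooth test functions to Lipschitz ones, as the
truncation used for comparison is not smooth. The uniform bounds on mollifications provide one
integrable majorant. -/
lemma SolvesEquation.lipschitz_test (hN : 1 ≤ N) (hs0 : 0 < s) (hs1 : s < 1) {h : ℝ}
    {g u : EuclideanSpace ℝ (Fin N) → ℝ}
    {z : EuclideanSpace ℝ (Fin N) × EuclideanSpace ℝ (Fin N) → ℝ} (hz : IsCalibration u z)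
    (heq : SolvesEquation s h g u z) (hu : Continuous u) (hg : Continuous g)
    {φ : EuclideanSpace ℝ (Fin N) → ℝ} {L : ℝ≥0}
    (hφ : LipschitzWith L φ) (hc : HasCompactSupport φ) :
    -h * nonlocalDiv s z φ + ∫ x, u x * φ x = ∫ x, g x * φ x := by
  obtain ⟨φ', M, S, hS, hsm, hL, hM, h0, hlim⟩ := exists_smooth_approx hφ hc
  have hloc {f : EuclideanSpace ℝ (Fin N) → ℝ} (hf : Continuous f) :
      Tendsto (fun n => ∫ x, f x * φ' n x) atTop (𝓝 (∫ x, f x * φ x)) := by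
    refine tendsto_integral_of_dominated_convergence (S.indicator fun x => |f x| * M)
      (fun n => (hf.mul (hL n).continuous).aestronglyMeasurable) ?_
      (fun n => ae_of_all _ fun x => ?_) (ae_of_all _ fun x => (hlim x).const_mul _)
    · rw [integrable_indicator_iff hS.measurableSet]
      exact (hf.abs.mul continuous_const).continuousOn.integrableOn_compact hS
    · by_cases hx : x ∈ S
      · rw [indicator_of_mem hx, norm_mul, Real.norm_eq_abs, Real.norm_eq_abs]
        exact mul_le_mul_of_nonneg_left (hM n x) (abs_nonneg _)
      · simp [h0 n x hx, hx]
  have hdiv : Tendsto (fun n => nonlocalDiv s z (φ' n)) atTop (𝓝 (nonlocalDiv s z φ)) := by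
    simp only [nonlocalDiv_eq]
    refine (Tendsto.const_mul _ ?_).neg
    refine tendsto_integral_of_dominated_convergence (fun p => (L + 2 * M) * majorant s S p)
      (fun n => ?_) ((integrable_majorant hN hs0 hs1 hS.measurableSet
        hS.measure_lt_top.ne).const_mul _) (fun n => ?_) (ae_of_all _ fun p => ?_)
    · have h1 := (hL n).continuous
      have h2 := measurable_sKernel (N := N) (s := s)
      exact hz.1.1.mul (Measurable.aestronglyMeasurable (by fun_prop))
    · filter_upwards [hz.ae_abs_le] with p hp
      rw [norm_mul, Real.norm_eq_abs, Real.norm_eq_abs]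
      exact (mul_le_of_le_one_left (abs_nonneg _) hp).trans
        (abs_diff_mul_sKernel_le (hL n) (hM n) (h0 n) p)
    · exact (((hlim p.1).sub (hlim p.2)).mul_const _).const_mul _
  refine tendsto_nhds_unique (((hdiv.const_mul (-h)).add (hloc hu)).congr fun n => ?_) (hloc hg)
  exact heq (φ' n) (hsm n) (HasCompactSupport.intro hS (h0 n))

lemma isCompact_sublevel {u : EuclideanSpace ℝ (Fin N) → ℝ} (hu : u ∈ LPlus N) (t : ℝ) :
    IsCompact {x | u x ≤ t} := by
  obtain ⟨⟨K, hK⟩, hlim⟩ := hu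
  refine Metric.isCompact_of_isClosed_isBounded (isClosed_le hK.continuous continuous_const) ?_
  rw [← Bornology.isCobounded_compl_iff, Bornology.isCobounded_def]
  filter_upwards [hlim.eventually_gt_atTop t] with x hx
  simpa using hx

/-- If z₁ < z₂, then z₁ ≠ 1 and z₂ ≠ -1, which forces a₁ ≤ b₁ and b₂ ≤ a₂; the truncated difference
is increasing in its first argument and decreasing in the second. The case z₁ > z₂ is symmetric. -/
lemma calibration_mul_truncated_diff_nonneg {z₁ z₂ a₁ a₂ b₁ b₂ : ℝ} (T : ℝ) (hz₁ : |z₁| ≤ 1)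
    (hz₂ : |z₂| ≤ 1) (h₁ : z₁ * (a₁ - b₁) = |a₁ - b₁|) (h₂ : z₂ * (a₂ - b₂) = |a₂ - b₂|) :
    0 ≤ (z₁ - z₂) * (max 0 (min a₁ T - a₂) - max 0 (min b₁ T - b₂)) := by
  have key {z a b : ℝ} (h : z * (a - b) = |a - b|) (hlt : a < b) : z = -1 := by
    rw [abs_of_neg (by linarith)] at h
    have : (z + 1) * (a - b) = 0 := by linarith
    rcases mul_eq_zero.1 this with h | h <;> linarith
  have key' {z a b : ℝ} (h : z * (a - b) = |a - b|) (hlt : b < a) : z = 1 := by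
    have := key (z := -z) (a := b) (b := a) (by rw [abs_sub_comm, ← h]; ring) hlt
    linarith
  rw [abs_le] at hz₁ hz₂
  rcases lt_trichotomy z₁ z₂ with hz | hz | hz
  · have h1 : a₁ ≤ b₁ := by
      by_contra! hc
      linarith [key' h₁ hc]
    have h2 : b₂ ≤ a₂ := by
      by_contra! hc
      linarith [key h₂ hc]
    refine mul_nonneg_of_nonpos_of_nonpos (by linarith) (sub_nonpos.2 ?_)
    gcongr
  · simp [hz]
  · have h1 : b₁ ≤ a₁ := by
      by_contra! hc
      linarith [key h₁ hc]
    have h2 : a₂ ≤ b₂ := by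
      by_contra! hc
      linarith [key' h₂ hc]
    refine mul_nonneg (by linarith) (sub_nonneg.2 ?_)
    gcongr

/-- Only u₂ has to tend to +∞: cutting u₁ at T confines the test function to the compact set {u₂ ≤
T}. Leaving u₁ merely Lipschitz also covers the case of u₁ in 𝓛⁻. -/
theorem comparison_of_mem_LPlus (hN : 1 ≤ N) (hs0 : 0 < s) (hs1 : s < 1) {h : ℝ} (hh : 0 < h)
    {g₁ g₂ u₁ u₂ : EuclideanSpace ℝ (Fin N) → ℝ} {K₁ : ℝ≥0} (hg₁ : Continuous g₁)
    (hg₂ : Continuous g₂) (hu₁ : LipschitzWith K₁ u₁) (hu₂ : u₂ ∈ LPlus N)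
    (hs₁ : IsSolution s h g₁ u₁) (hs₂ : IsSolution s h g₂ u₂) (hle : ∀ x, g₁ x ≤ g₂ x)
    (x : EuclideanSpace ℝ (Fin N)) : u₁ x ≤ u₂ x := by
  by_contra! hx
  obtain ⟨z₁, hz₁, he₁⟩ := hs₁
  obtain ⟨z₂, hz₂, he₂⟩ := hs₂
  obtain ⟨K₂, hK₂⟩ := hu₂.1
  -- With the cut at the height of u₁ at the bad point, the test function is still positive there.
  set T := u₁ x
  let φ (y : EuclideanSpace ℝ (Fin N)) : ℝ := max 0 (min (u₁ y) T - u₂ y)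
  have hφ : LipschitzWith (K₁ + K₂) φ := ((hu₁.min_const T).sub hK₂).const_max 0
  have hφ0 (y) : 0 ≤ φ y := le_max_left _ _
  have hc : HasCompactSupport φ := by
    refine HasCompactSupport.intro (isCompact_sublevel hu₂ T) fun y hy => max_eq_left ?_
    have : T < u₂ y := not_le.1 hy
    linarith [min_le_right (u₁ y) T]
  have e₁ := he₁.lipschitz_test hN hs0 hs1 hz₁ hu₁.continuous hg₁ hφ hc
  have e₂ := he₂.lipschitz_test hN hs0 hs1 hz₂ hK₂.continuous hg₂ hφ hc
  have hD := integrable_diff_mul_sKernel hN hs0 hs1 hφ hc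
  have hint {f : EuclideanSpace ℝ (Fin N) → ℝ} (hf : Continuous f) :
      Integrable fun y => f y * φ y :=
    (hf.mul hφ.continuous).integrable_of_hasCompactSupport hc.mul_left
  have hdiv : 0 ≤ nonlocalDiv s z₂ φ - nonlocalDiv s z₁ φ := by
    rw [nonlocalDiv_eq, nonlocalDiv_eq, neg_sub_neg, ← mul_sub, ← integral_sub]
    · refine mul_nonneg (by linarith [cs_pos (N := N) hs1]) (integral_nonneg_of_ae ?_)
      filter_upwards [hz₁.ae_abs_le, hz₂.ae_abs_le, hz₁.2.2, hz₂.2.2] with p h1 h2 h3 h4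
      rw [← sub_mul, ← mul_assoc]
      exact mul_nonneg (calibration_mul_truncated_diff_nonneg T h1 h2 h3 h4) (sKernel_nonneg _)
    · exact hD.bdd_mul (c := 1) hz₁.1.1 hz₁.ae_abs_le
    · exact hD.bdd_mul (c := 1) hz₂.1.1 hz₂.ae_abs_le
  have hgle : ∫ y, g₁ y * φ y ≤ ∫ y, g₂ y * φ y :=
    integral_mono (hint hg₁) (hint hg₂) fun y => mul_le_mul_of_nonneg_right (hle y) (hφ0 y)
  -- Where φ > 0 it equals min(u₁, T) - u₂, which is at most u₁ - u₂.
  have hule : ∫ y, φ y * φ y ≤ (∫ y, u₁ y * φ y) - ∫ y, u₂ y * φ y := by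
    rw [← integral_sub (hint hu₁.continuous) (hint hK₂.continuous)]
    refine integral_mono (hint hφ.continuous)
      ((hint hu₁.continuous).sub (hint hK₂.continuous)) fun y => ?_
    simp only
    rw [← sub_mul]
    rcases (hφ0 y).eq_or_lt with h0 | h0
    · simp [← h0]
    · refine mul_le_mul_of_nonneg_right ?_ (hφ0 y)
      have : φ y = min (u₁ y) T - u₂ y := max_eq_right (by
        by_contra! hc
        exact h0.ne' (max_eq_left hc.le))
      linarith [min_le_left (u₁ y) T]
  have hpos : 0 < ∫ y, φ y * φ y := by
    refine (hφ.continuous.mul hφ.continuous).integral_pos_of_hasCompactSupport_nonneg_nonzero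
      hc.mul_left (fun y => mul_self_nonneg _) (x := x) (mul_self_ne_zero.2 ?_)
    simp only [φ, T, min_self]
    rw [max_eq_right (by linarith)]
    linarith
  nlinarith

end Comparison

end FracROF

namespace FracROF

/-! ### Testing the equation with indicators: perimeter of sublevel sets. -/

section Geometric

open Topology

variable {N : ℕ} {s h : ℝ}

/-- The fractional perimeter is half the Gagliardo seminorm of the indicator function. -/
lemma fracPer_eq (F : Set (EuclideanSpace ℝ (Fin N))) (hF : NullMeasurableSet F) :
    fracPer s F = ENNReal.ofReal (cs N s / 2) *
      ∫⁻ p : EuclideanSpace ℝ (Fin N) × EuclideanSpace ℝ (Fin N),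
        ‖(F.indicator (1 : EuclideanSpace ℝ (Fin N) → ℝ) p.1 - F.indicator 1 p.2) * sKernel s (p.1 - p.2)‖ₑ := by
  let κ (p : EuclideanSpace ℝ (Fin N) × EuclideanSpace ℝ (Fin N)) : ℝ≥0∞ :=
    ENNReal.ofReal (sKernel s (p.1 - p.2))
  have hκ : Measurable κ := by
    have := measurable_sKernel (N := N) (s := s)
    fun_prop
  have hS : NullMeasurableSet (F ×ˢ Fᶜ) (volume.prod volume) := hF.prod hF.compl
  -- The difference of indicators is nonzero exactly on F × Fᶜ and its mirror image, which
  -- contribute equally; this accounts for the factor 1/2.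
  have hpt (p : EuclideanSpace ℝ (Fin N) × EuclideanSpace ℝ (Fin N)) :
      ‖(F.indicator (1 : EuclideanSpace ℝ (Fin N) → ℝ) p.1 - F.indicator 1 p.2) * sKernel s (p.1 - p.2)‖ₑ =
        (F ×ˢ Fᶜ).indicator κ p + (F ×ˢ Fᶜ).indicator κ p.swap := by
    have e1 : sKernel s (p.2 - p.1) = sKernel s (p.1 - p.2) := by rw [← sKernel_neg, neg_sub]
    by_cases h1 : p.1 ∈ F <;> by_cases h2 : p.2 ∈ F <;>
      simp [h1, h2, κ, indicator, e1, Real.enorm_eq_ofReal, sKernel_nonneg]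
  have hm : AEMeasurable ((F ×ˢ Fᶜ).indicator κ) (volume.prod volume) :=
    hκ.aemeasurable.indicator₀ hS
  have hint : ∫⁻ p, (F ×ˢ Fᶜ).indicator κ p ∂(volume.prod volume) =
      ∫⁻ x in F, ∫⁻ y in Fᶜ, ENNReal.ofReal (1 / ‖x - y‖ ^ ((N : ℝ) + s)) := by
    rw [lintegral_indicator₀ hS, ← Measure.prod_restrict, lintegral_prod _ hκ.aemeasurable]
    rfl
  simp_rw [hpt]
  rw [Measure.volume_eq_prod, lintegral_add_left' hm, lintegral_prod_swap, hint, ← two_mul,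
    ← mul_assoc, fracPer]
  congr 1
  rw [show (2 : ℝ≥0∞) = ENNReal.ofReal 2 by simp, ← ENNReal.ofReal_mul' zero_le_two]
  congr 1
  ring

lemma integrable_indicator_diff (hs1 : s < 1) {F : Set (EuclideanSpace ℝ (Fin N))}
    (hF : NullMeasurableSet F) (hP : fracPer s F ≠ ⊤) :
    Integrable (fun p : EuclideanSpace ℝ (Fin N) × EuclideanSpace ℝ (Fin N) =>
      (F.indicator (1 : EuclideanSpace ℝ (Fin N) → ℝ) p.1 - F.indicator 1 p.2) * sKernel s (p.1 - p.2)) := by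
  have hm : AEStronglyMeasurable (F.indicator (1 : EuclideanSpace ℝ (Fin N) → ℝ)) :=
    aestronglyMeasurable_one.indicator₀ hF
  refine ⟨(hm.comp_fst.sub hm.comp_snd).mul ?_, ?_⟩
  · have := measurable_sKernel (N := N) (s := s)
    exact Measurable.aestronglyMeasurable (by fun_prop)
  · rw [fracPer_eq F hF] at hP
    refine lt_top_iff_ne_top.2 fun htop => hP ?_
    rw [htop, ENNReal.mul_top]
    simpa using cs_pos hs1

lemma toReal_fracPer (hs1 : s < 1) {F : Set (EuclideanSpace ℝ (Fin N))}
    (hF : NullMeasurableSet F) (hP : fracPer s F ≠ ⊤) :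
    (fracPer s F).toReal = cs N s / 2 *
      ∫ p : EuclideanSpace ℝ (Fin N) × EuclideanSpace ℝ (Fin N),
        |(F.indicator (1 : EuclideanSpace ℝ (Fin N) → ℝ) p.1 - F.indicator 1 p.2) * sKernel s (p.1 - p.2)| := by
  have h1 := integral_norm_eq_lintegral_enorm (integrable_indicator_diff hs1 hF hP).1
  simp only [Real.norm_eq_abs] at h1
  rw [h1, fracPer_eq F hF, ENNReal.toReal_mul, ENNReal.toReal_ofReal]
  linarith [cs_pos (N := N) hs1]

variable {g u : EuclideanSpace ℝ (Fin N) → ℝ}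
  {z : EuclideanSpace ℝ (Fin N) × EuclideanSpace ℝ (Fin N) → ℝ}

lemma integral_mul_indicator_one {F : Set (EuclideanSpace ℝ (Fin N))} (hF : NullMeasurableSet F)
    (f : EuclideanSpace ℝ (Fin N) → ℝ) : ∫ x, f x * F.indicator 1 x = ∫ x in F, f x := by
  rw [← integral_indicator₀ hF]
  congr 1
  ext x
  by_cases hx : x ∈ F <;> simp [hx]

lemma integrable_indicator_one {F : Set (EuclideanSpace ℝ (Fin N))} (hF : NullMeasurableSet F)
    (hv : volume F ≠ ⊤) : Integrable (F.indicator (1 : EuclideanSpace ℝ (Fin N) → ℝ)) :=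
  (integrableOn_const hv).integrable_indicator₀ hF

/-- The indicator of F is an admissible test function once F has finite measure and perimeter, and
|z| ≤ 1 bounds the nonlocal term by the seminorm. -/
lemma WeakEquation.setIntegral_le (hW : WeakEquation s h g u z) (hs1 : s < 1) (hh : 0 < h)
    (hzb : ∀ p, |z p| ≤ 1) {F : Set (EuclideanSpace ℝ (Fin N))} (hF : NullMeasurableSet F)
    (hv : volume F ≠ ⊤) (hP : fracPer s F ≠ ⊤) :
    ∫ x in F, (u x - g x) ≤ h * (fracPer s F).toReal := by
  have hc : 0 < h * cs N s / 2 := half_pos (mul_pos hh (cs_pos hs1))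
  have hD := integrable_indicator_diff hs1 hF hP
  have h1 := hW _ (integrable_indicator_one hF hv) hD
  rw [integral_mul_indicator_one hF fun x => u x - g x] at h1
  rw [h1, toReal_fracPer hs1 hF hP, ← mul_assoc, ← mul_div_assoc, neg_mul, ← mul_neg]
  refine mul_le_mul_of_nonneg_left ((neg_le_abs _).trans ?_) hc.le
  rw [← Real.norm_eq_abs]
  refine norm_integral_le_of_norm_le hD.abs (ae_of_all _ fun p => ?_)
  rw [norm_mul, Real.norm_eq_abs, Real.norm_eq_abs]
  exact mul_le_of_le_one_left (abs_nonneg _) (hzb p)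

/-- Where a ≠ b the calibration is the sign of a - b, and an antitone map reverses that sign. -/
lemma calibration_mul_antitone {θ : ℝ → ℝ} (hθ : Antitone θ) {w a b : ℝ}
    (hw : w * (a - b) = |a - b|) : w * (θ a - θ b) = -|θ a - θ b| := by
  rcases lt_trichotomy a b with h | h | h
  · rw [abs_of_neg (by linarith)] at hw
    have : w = -1 := mul_right_cancel₀ (sub_ne_zero.2 h.ne) (by linarith)
    rw [abs_of_nonneg (sub_nonneg.2 (hθ h.le)), this, neg_one_mul]
  · simp [h]
  · rw [abs_of_pos (by linarith)] at hw
    have : w = 1 := mul_right_cancel₀ (sub_ne_zero.2 h.ne') (by linarith)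
    rw [abs_of_nonpos (sub_nonpos.2 (hθ h.le)), this]
    ring

lemma WeakEquation.integral_comp_antitone (hW : WeakEquation s h g u z)
    (hcal : ∀ p, z p * (u p.1 - u p.2) = |u p.1 - u p.2|) {θ : ℝ → ℝ} (hθ : Antitone θ)
    (hi : Integrable fun x => θ (u x))
    (hD : Integrable (fun p : EuclideanSpace ℝ (Fin N) × EuclideanSpace ℝ (Fin N) =>
      (θ (u p.1) - θ (u p.2)) * sKernel s (p.1 - p.2))) :
    ∫ x, (u x - g x) * θ (u x) =
      (h * cs N s / 2) * ∫ p : EuclideanSpace ℝ (Fin N) × EuclideanSpace ℝ (Fin N),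
        |(θ (u p.1) - θ (u p.2)) * sKernel s (p.1 - p.2)| := by
  rw [hW _ hi hD, neg_mul, ← mul_neg, ← integral_neg]
  congr 2
  ext p
  rw [← mul_assoc, calibration_mul_antitone hθ (hcal p), abs_mul,
    abs_of_nonneg (sKernel_nonneg _)]
  ring

/-- A sublevel set of `u` which is a limit of Lipschitz cut-offs has finite perimeter. -/
lemma WeakEquation.fracPer_ne_top (hW : WeakEquation s h g u z) (hN : 1 ≤ N) (hs0 : 0 < s)
    (hs1 : s < 1) (hh : 0 < h) (hcal : ∀ p, z p * (u p.1 - u p.2) = |u p.1 - u p.2|)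
    (hu : u ∈ LPlus N) {C : ℝ} (hC : ∀ x, |u x - g x| ≤ C) {J : Set ℝ} (hJ : MeasurableSet J)
    {T : ℝ} {θ : ℕ → ℝ → ℝ} {L : ℕ → ℝ≥0} (hθ : ∀ n, Antitone (θ n))
    (hθL : ∀ n, LipschitzWith (L n) (θ n)) (hθb : ∀ n r, |θ n r| ≤ 1)
    (hθT : ∀ n r, T < r → θ n r = 0)
    (hlim : ∀ r, Tendsto (fun n => θ n r) atTop (𝓝 (J.indicator 1 r))) :
    fracPer s (u ⁻¹' J) ≠ ⊤ := by
  obtain ⟨K, hK⟩ := hu.1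
  have hc : 0 < h * cs N s / 2 := half_pos (mul_pos hh (cs_pos hs1))
  have hE : MeasurableSet (u ⁻¹' J) := hK.continuous.measurable hJ
  set S : Set (EuclideanSpace ℝ (Fin N)) := {x | u x ≤ T}
  have hS : IsCompact S := isCompact_sublevel hu T
  have hLip (n : ℕ) : LipschitzWith (L n * K) fun x => θ n (u x) := (hθL n).comp hK
  have h0 (n : ℕ) (x) (hx : x ∉ S) : θ n (u x) = 0 := hθT n _ (not_le.1 hx)
  have hcs (n : ℕ) : HasCompactSupport fun x => θ n (u x) := HasCompactSupport.intro hS (h0 n)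
  have hC0 : 0 ≤ C := (abs_nonneg _).trans (hC 0)
  -- The seminorm of each cut-off equals, up to a constant, the integral of (u - g) θ(u), which is
  -- at most C times the measure of the compact set {u ≤ T}. This does not involve the growing
  -- Lipschitz constants, so Fatou's lemma applies.
  have hbound (n : ℕ) : ∫⁻ p : EuclideanSpace ℝ (Fin N) × EuclideanSpace ℝ (Fin N),
      ‖(θ n (u p.1) - θ n (u p.2)) * sKernel s (p.1 - p.2)‖ₑ ≤
        ENNReal.ofReal ((C * volume.real S) / (h * cs N s / 2)) := by
    have hD := integrable_diff_mul_sKernel hN hs0 hs1 (hLip n) (hcs n)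
    rw [← ofReal_integral_norm_eq_lintegral_enorm hD]
    refine ENNReal.ofReal_le_ofReal ?_
    rw [le_div_iff₀' hc]
    have h1 := hW.integral_comp_antitone hcal (hθ n)
      ((hLip n).continuous.integrable_of_hasCompactSupport (hcs n)) hD
    simp only [Real.norm_eq_abs]
    rw [← h1]
    have h2 : ∫ x, S.indicator (fun _ => C) x = C * volume.real S := by
      rw [integral_indicator hS.measurableSet, setIntegral_const, smul_eq_mul, mul_comm]
    rw [← h2]
    refine (le_abs_self _).trans ?_
    rw [← Real.norm_eq_abs]
    refine norm_integral_le_of_norm_le ((integrable_indicator_iff hS.measurableSet).2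
      (integrableOn_const hS.measure_lt_top.ne)) (ae_of_all _ fun x => ?_)
    by_cases hx : x ∈ S
    · rw [indicator_of_mem hx, norm_mul, Real.norm_eq_abs, Real.norm_eq_abs]
      exact (mul_le_of_le_one_right (abs_nonneg _) (hθb n _)).trans (hC x)
    · simp [hx, h0 n x hx]
  have hmeas := measurable_sKernel (N := N) (s := s)
  have hfatou := lintegral_liminf_le (μ := volume) (u := atTop)
    (f := fun n (p : EuclideanSpace ℝ (Fin N) × EuclideanSpace ℝ (Fin N)) =>
      ‖(θ n (u p.1) - θ n (u p.2)) * sKernel s (p.1 - p.2)‖ₑ) fun n => by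
    have := (hLip n).continuous.measurable
    exact ((((this.comp measurable_fst).sub (this.comp measurable_snd))).mul
      (hmeas.comp (measurable_fst.sub measurable_snd))).enorm
  have hind (x) : (u ⁻¹' J).indicator (1 : EuclideanSpace ℝ (Fin N) → ℝ) x = J.indicator 1 (u x) := rfl
  have hlim' (p : EuclideanSpace ℝ (Fin N) × EuclideanSpace ℝ (Fin N)) :
      liminf (fun n => ‖(θ n (u p.1) - θ n (u p.2)) * sKernel s (p.1 - p.2)‖ₑ) atTop =
        ‖((u ⁻¹' J).indicator (1 : EuclideanSpace ℝ (Fin N) → ℝ) p.1 - (u ⁻¹' J).indicator 1 p.2) *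
          sKernel s (p.1 - p.2)‖ₑ := by
    rw [hind, hind]
    exact ((((hlim (u p.1)).sub (hlim (u p.2))).mul_const _).enorm).liminf_eq
  simp only [hlim'] at hfatou
  rw [fracPer_eq _ hE.nullMeasurableSet]
  refine ENNReal.mul_ne_top ENNReal.ofReal_ne_top (ne_top_of_le_ne_top ?_ hfatou)
  have hle : liminf (fun n => ∫⁻ p : EuclideanSpace ℝ (Fin N) × EuclideanSpace ℝ (Fin N),
      ‖(θ n (u p.1) - θ n (u p.2)) * sKernel s (p.1 - p.2)‖ₑ) atTop ≤
        ENNReal.ofReal ((C * volume.real S) / (h * cs N s / 2)) :=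
    liminf_le_of_le (f := atTop) (by isBoundedDefault) fun b hb =>
      hb.exists.elim fun n hn => hn.trans (hbound n)
  exact ne_top_of_le_ne_top ENNReal.ofReal_ne_top hle

/-- The indicator of a sublevel set is an antitone function of u, so no loss occurs in the bound of
`WeakEquation.setIntegral_le`. -/
lemma WeakEquation.setIntegral_sublevel (hW : WeakEquation s h g u z) (hs1 : s < 1)
    (hcal : ∀ p, z p * (u p.1 - u p.2) = |u p.1 - u p.2|) {J : Set ℝ} (hJl : IsLowerSet J)
    (hE : MeasurableSet (u ⁻¹' J)) (hv : volume (u ⁻¹' J) ≠ ⊤)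
    (hP : fracPer s (u ⁻¹' J) ≠ ⊤) :
    ∫ x in u ⁻¹' J, (u x - g x) = h * (fracPer s (u ⁻¹' J)).toReal := by
  have hanti : Antitone (J.indicator (1 : ℝ → ℝ)) := fun a b hab => by
    by_cases hb : b ∈ J
    · simp [hb, hJl hab hb]
    · rw [indicator_of_notMem hb]
      exact indicator_nonneg (fun _ _ => zero_le_one) a
  have h1 := hW.integral_comp_antitone hcal hanti
    (integrable_indicator_one hE.nullMeasurableSet hv)
    (integrable_indicator_diff hs1 hE.nullMeasurableSet hP)
  have h2 := integral_mul_indicator_one hE.nullMeasurableSet fun x => u x - g x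
  rw [← h2, toReal_fracPer hs1 hE.nullMeasurableSet hP, ← mul_assoc, ← mul_div_assoc]
  exact h1

/-- The decreasing ramp of slope `-(n + 1)`, clamped to `[0, 1]`, with value `c` at `t`. -/
noncomputable def ramp (c t : ℝ) (n : ℕ) (r : ℝ) : ℝ :=
  max 0 (min 1 (c + ((n : ℝ) + 1) * (t - r)))

lemma ramp_antitone (c t : ℝ) (n : ℕ) : Antitone (ramp c t n) := fun a b hab => by
  unfold ramp
  gcongr

lemma ramp_lipschitz (c t : ℝ) (n : ℕ) : LipschitzWith (n + 1 : ℝ≥0) (ramp c t n) := by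
  have h : LipschitzWith (n + 1 : ℝ≥0) fun r : ℝ => c + ((n : ℝ) + 1) * (t - r) :=
    LipschitzWith.of_dist_le_mul fun a b => by
      rw [Real.dist_eq, Real.dist_eq, add_sub_add_left_eq_sub, ← mul_sub, abs_mul,
        abs_of_nonneg (by positivity), sub_sub_sub_cancel_left, abs_sub_comm]
      simp
  exact (h.const_min 1).const_max 0

lemma abs_ramp_le (c t : ℝ) (n : ℕ) (r : ℝ) : |ramp c t n r| ≤ 1 := by
  rw [abs_of_nonneg (le_max_left _ _)]
  exact max_le zero_le_one (min_le_left _ _)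

lemma ramp_eq_zero {c t r : ℝ} (hc : c ≤ 1) (hr : t + 1 < r) (n : ℕ) : ramp c t n r = 0 := by
  refine max_eq_left ((min_le_right _ _).trans ?_)
  nlinarith [(Nat.cast_nonneg n : (0 : ℝ) ≤ n)]

lemma tendsto_ramp_of_lt {c t r : ℝ} (hr : r < t) :
    Tendsto (fun n => ramp c t n r) atTop (𝓝 1) := by
  have h1 : Tendsto (fun n : ℕ => c + ((n : ℝ) + 1) * (t - r)) atTop atTop :=
    tendsto_atTop_add_const_left _ _ ((tendsto_atTop_add_const_right _ _
      tendsto_natCast_atTop_atTop).atTop_mul_const (sub_pos.2 hr))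
  refine tendsto_const_nhds.congr' ?_
  filter_upwards [h1.eventually_ge_atTop 1] with n hn
  rw [ramp, min_eq_left hn, max_eq_right zero_le_one]

lemma tendsto_ramp_of_gt {c t r : ℝ} (hr : t < r) :
    Tendsto (fun n => ramp c t n r) atTop (𝓝 0) := by
  have h1 : Tendsto (fun n : ℕ => c + ((n : ℝ) + 1) * (t - r)) atTop atBot :=
    tendsto_atBot_add_const_left _ _ ((tendsto_atTop_add_const_right _ _
      tendsto_natCast_atTop_atTop).atTop_mul_const_of_neg (sub_neg.2 hr))
  refine tendsto_const_nhds.congr' ?_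
  filter_upwards [h1.eventually_le_atBot 0] with n hn
  rw [ramp, max_eq_left ((min_le_right _ _).trans hn)]

/-- The value c at t survives in the limit: c = 0 selects {r < t}, and c = 1 selects {r ≤ t}. -/
lemma tendsto_ramp_zero (t r : ℝ) :
    Tendsto (fun n => ramp 0 t n r) atTop (𝓝 ((Iio t).indicator 1 r)) := by
  rcases lt_trichotomy r t with h | h | h
  · simpa [h] using tendsto_ramp_of_lt h
  · simp [h, ramp]
  · simpa [h.le] using tendsto_ramp_of_gt h

lemma tendsto_ramp_one (t r : ℝ) :
    Tendsto (fun n => ramp 1 t n r) atTop (𝓝 ((Iic t).indicator 1 r)) := by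
  rcases lt_trichotomy r t with h | h | h
  · simpa [h.le] using tendsto_ramp_of_lt h
  · simp [h, ramp]
  · simpa [h] using tendsto_ramp_of_gt h

end Geometric

/-! ### Minimizers of the geometric energy. -/

section Energy

variable {N : ℕ} {s h : ℝ}

lemma energy_eq {f : EuclideanSpace ℝ (Fin N) → ℝ} {F : Set (EuclideanSpace ℝ (Fin N))}
    (hP : fracPer s F ≠ ⊤) (hf : IntegrableOn f F) :
    energy s h f F = (((fracPer s F).toReal + 1 / h * ∫ x in F, f x : ℝ) : EReal) := by
  have h1 : ∫⁻ x in F, ENNReal.ofReal (f x) ≠ ⊤ := hf.lintegral_lt_top.ne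
  have h2 : ∫⁻ x in F, ENNReal.ofReal (-f x) ≠ ⊤ := hf.neg.lintegral_lt_top.ne
  rw [energy, extIntegral, integral_eq_lintegral_pos_part_sub_lintegral_neg_part hf,
    ← EReal.coe_ennreal_toReal hP, ← EReal.coe_ennreal_toReal h1, ← EReal.coe_ennreal_toReal h2]
  norm_cast

/-- A finite integral of the negative part excludes ∞ - ∞, so an infinite perimeter or an infinite
positive part makes the energy infinite. -/
lemma finite_of_energy_ne_top (hh : 0 < h) {f : EuclideanSpace ℝ (Fin N) → ℝ}
    {F : Set (EuclideanSpace ℝ (Fin N))} (hf : AEStronglyMeasurable f)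
    (hneg : ∫⁻ x, ENNReal.ofReal (-f x) ≠ ⊤) (hE : energy s h f F ≠ ⊤) :
    fracPer s F ≠ ⊤ ∧ IntegrableOn f F := by
  have h2 : ∫⁻ x in F, ENNReal.ofReal (-f x) ≠ ⊤ :=
    ne_top_of_le_ne_top hneg (setLIntegral_le_lintegral _ _)
  have hh' : 0 < 1 / h := by positivity
  have h1 : ∫⁻ x in F, ENNReal.ofReal (f x) ≠ ⊤ := by
    intro htop
    refine hE ?_
    rw [energy, extIntegral, htop, ← EReal.coe_ennreal_toReal h2, EReal.coe_ennreal_top,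
      EReal.top_sub_coe, EReal.coe_mul_top_of_pos hh']
    exact EReal.add_top_of_ne_bot (EReal.coe_ennreal_ne_bot _)
  refine ⟨fun htop => hE ?_, ⟨hf.restrict, ?_⟩⟩
  · rw [energy, extIntegral, htop, ← EReal.coe_ennreal_toReal h1, ← EReal.coe_ennreal_toReal h2,
      EReal.coe_ennreal_top, ← EReal.coe_sub, ← EReal.coe_mul, EReal.top_add_coe]
  · have h3 (x) : ‖f x‖ₑ ≤ ENNReal.ofReal (f x) + ENNReal.ofReal (-f x) := by
      rw [Real.enorm_eq_ofReal_abs]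
      rcases le_total 0 (f x) with h | h
      · rw [abs_of_nonneg h]; exact le_self_add
      · rw [abs_of_nonpos h]; exact le_add_self
    refine (lintegral_mono h3).trans_lt ?_
    rw [lintegral_add_left' hf.restrict.aemeasurable.ennreal_ofReal]
    exact ENNReal.add_lt_top.2 ⟨h1.lt_top, h2.lt_top⟩

/-- Outside the compact set {g ≤ t + 1} the integrand is at least 1, so Markov's inequality bounds
the rest of F. -/
lemma measure_lt_top_of_integrableOn {g : EuclideanSpace ℝ (Fin N) → ℝ} (hg : g ∈ LPlus N)
    {t : ℝ} {F : Set (EuclideanSpace ℝ (Fin N))} (hF : IntegrableOn (fun x => g x - t) F) :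
    volume F < ⊤ := by
  have h1 := Integrable.measure_norm_ge_lt_top hF zero_lt_one
  obtain ⟨K, hK⟩ := hg.1
  have hc := hK.continuous
  rw [Measure.restrict_apply (isClosed_le (by fun_prop) (by fun_prop)).measurableSet] at h1
  refine (measure_mono (t := {x | g x ≤ t + 1} ∪ ({x | 1 ≤ ‖g x - t‖} ∩ F)) fun x hx => ?_).trans_lt
    (measure_union_lt_top (isCompact_sublevel hg _).measure_lt_top h1)
  rcases le_total (g x) (t + 1) with h | h
  · exact Or.inl h
  · refine Or.inr ⟨?_, hx⟩
    simp only [mem_ofPred_eq, Real.norm_eq_abs]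
    exact le_trans (by linarith) (le_abs_self _)

lemma hasCompactSupport_min_sub {u : EuclideanSpace ℝ (Fin N) → ℝ} (hu : u ∈ LPlus N) (t : ℝ) :
    HasCompactSupport fun x => min (u x - t) 0 :=
  HasCompactSupport.intro (isCompact_sublevel hu t) fun x hx => by
    have : t < u x := not_le.1 hx
    exact min_eq_right (by linarith)

lemma integrable_min_sub {u : EuclideanSpace ℝ (Fin N) → ℝ} (hu : u ∈ LPlus N) (t : ℝ) :
    Integrable fun x => min (u x - t) 0 := by
  obtain ⟨K, hK⟩ := hu.1
  have := hK.continuous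
  exact Continuous.integrable_of_hasCompactSupport (by fun_prop) (hasCompactSupport_min_sub hu t)

lemma lintegral_neg_sub_ne_top {g : EuclideanSpace ℝ (Fin N) → ℝ} (hg : g ∈ LPlus N) (t : ℝ) :
    ∫⁻ x, ENNReal.ofReal (-(g x - t)) ≠ ⊤ := by
  refine ne_top_of_le_ne_top (integrable_min_sub hg t).neg.lintegral_lt_top.ne
    (lintegral_mono fun x => ENNReal.ofReal_le_ofReal ?_)
  exact neg_le_neg (min_le_left _ _)

lemma setIntegral_sublevel_eq {u : EuclideanSpace ℝ (Fin N) → ℝ} {t : ℝ} {J : Set ℝ}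
    (hE : MeasurableSet (u ⁻¹' J)) (h1 : Iio t ⊆ J) (h2 : J ⊆ Iic t) :
    ∫ x in u ⁻¹' J, (u x - t) = ∫ x, min (u x - t) 0 := by
  rw [← integral_indicator hE]
  congr 1
  ext x
  by_cases hx : x ∈ u ⁻¹' J
  · have : u x ≤ t := h2 hx
    rw [indicator_of_mem hx, min_eq_left (by linarith)]
  · have : t ≤ u x := not_lt.1 fun hlt => hx (h1 hlt)
    rw [indicator_of_notMem hx, min_eq_right (by linarith)]

/-- Among sets of finite measure, `F ↦ ∫_F (u - t)` is minimized exactly by the sets between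
`{u < t}` and `{u ≤ t}`. -/
lemma integral_min_le_setIntegral {u : EuclideanSpace ℝ (Fin N) → ℝ} (hu : u ∈ LPlus N) {t : ℝ}
    {F : Set (EuclideanSpace ℝ (Fin N))} (hF : NullMeasurableSet F)
    (hi : IntegrableOn (fun x => u x - t) F) :
    ∫ x, min (u x - t) 0 ≤ ∫ x in F, (u x - t) ∧
      (∫ x in F, (u x - t) ≤ ∫ x, min (u x - t) 0 →
        volume ({x | u x < t} \ F) = 0 ∧ volume (F \ {x | u x ≤ t}) = 0) := by
  have hm := integrable_min_sub hu t
  have hi' := hi.integrable_indicator₀ hF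
  have hpt (x) : min (u x - t) 0 ≤ F.indicator (fun x => u x - t) x := by
    by_cases hx : x ∈ F
    · rw [indicator_of_mem hx]; exact min_le_left _ _
    · rw [indicator_of_notMem hx]; exact min_le_right _ _
  rw [← integral_indicator₀ hF]
  refine ⟨integral_mono hm hi' hpt, fun hle => ?_⟩
  have h0 : ∫ x, (F.indicator (fun x => u x - t) x - min (u x - t) 0) = 0 := by
    rw [integral_sub hi' hm]
    linarith [integral_mono hm hi' hpt]
  have hae := (integral_eq_zero_iff_of_nonneg (fun x => sub_nonneg.2 (hpt x)) (hi'.sub hm)).1 h0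
  constructor
  · rw [measure_eq_zero_iff_ae_notMem]
    filter_upwards [hae] with x hx hmem
    have hlt : u x < t := hmem.1
    simp only [indicator_of_notMem hmem.2, Pi.zero_apply] at hx
    rw [min_eq_left (by linarith)] at hx
    linarith
  · rw [measure_eq_zero_iff_ae_notMem]
    filter_upwards [hae] with x hx hmem
    have hlt : t < u x := not_le.1 hmem.2
    simp only [indicator_of_mem hmem.1, Pi.zero_apply] at hx
    rw [min_eq_right (by linarith)] at hx
    linarith

/-- The energy of F is at least (1/h) ∫_F (u - t), which is at least (1/h) ∫ min(u - t, 0), and both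
sublevel sets attain this value. A minimizer has equality in the second bound too, which traps it
between them up to null sets. -/
theorem WeakEquation.isMinimizer {g u : EuclideanSpace ℝ (Fin N) → ℝ}
    {z : EuclideanSpace ℝ (Fin N) × EuclideanSpace ℝ (Fin N) → ℝ}
    (hW : WeakEquation s h g u z) (hN : 1 ≤ N) (hs0 : 0 < s) (hs1 : s < 1) (hh : 0 < h)
    (hzb : ∀ p, |z p| ≤ 1) (hcal : ∀ p, z p * (u p.1 - u p.2) = |u p.1 - u p.2|)
    (hu : u ∈ LPlus N) (hg : g ∈ LPlus N) {C : ℝ} (hC : ∀ x, |u x - g x| ≤ C) (t : ℝ) :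
    IsMinimalMinimizer (energy s h (fun x => g x - t)) {x | u x < t} ∧
      IsMaximalMinimizer (energy s h (fun x => g x - t)) {x | u x ≤ t} := by
  obtain ⟨Ku, hKu⟩ := hu.1
  obtain ⟨Kg, hKg⟩ := hg.1
  have huc := hKu.continuous
  have hgc := hKg.continuous
  have hd {F : Set (EuclideanSpace ℝ (Fin N))} (hv : volume F < ⊤) :
      IntegrableOn (fun x => u x - g x) F :=
    Measure.integrableOn_of_bounded hv.ne (huc.sub hgc).aestronglyMeasurable
      (ae_of_all _ fun x => by simpa using hC x)
  have hlow (F : Set (EuclideanSpace ℝ (Fin N))) (hF : NullMeasurableSet F)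
      (hE : energy s h (fun x => g x - t) F ≠ ⊤) :
      IntegrableOn (fun x => u x - t) F ∧
        ((1 / h * ∫ x in F, (u x - t) : ℝ) : EReal) ≤ energy s h (fun x => g x - t) F := by
    obtain ⟨hP, hi⟩ := finite_of_energy_ne_top (f := fun x => g x - t) hh
      (hgc.sub continuous_const).aestronglyMeasurable (lintegral_neg_sub_ne_top hg t) hE
    have hv := measure_lt_top_of_integrableOn hg hi
    have hsum : (fun x => u x - t) = fun x => (u x - g x) + (g x - t) := by ext; ring
    refine ⟨by rw [hsum]; exact (hd hv).add hi, ?_⟩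
    rw [energy_eq hP hi, EReal.coe_le_coe_iff, hsum, integral_add (hd hv) hi, mul_add]
    -- After writing u - t = (u - g) + (g - t), the lower bound is exactly the perimeter inequality
    -- for F.
    have := hW.setIntegral_le hs1 hh hzb hF hv.ne hP
    rw [add_le_add_iff_right, one_div, inv_mul_le_iff₀ hh]
    exact this
  have hval {J : Set ℝ} (hJ : MeasurableSet J) (hJl : IsLowerSet J) (h1 : Iio t ⊆ J)
      (h2 : J ⊆ Iic t) (hP : fracPer s (u ⁻¹' J) ≠ ⊤) :
      energy s h (fun x => g x - t) (u ⁻¹' J) = ((1 / h * ∫ x, min (u x - t) 0 : ℝ) : EReal) := by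
    have hE : MeasurableSet (u ⁻¹' J) := huc.measurable hJ
    have hsub : u ⁻¹' J ⊆ {x | u x ≤ t} := fun x hx => h2 hx
    have hcpt := isCompact_sublevel hu t
    have hv : volume (u ⁻¹' J) < ⊤ := (measure_mono hsub).trans_lt hcpt.measure_lt_top
    have hi : IntegrableOn (fun x => g x - t) (u ⁻¹' J) :=
      ((hgc.sub continuous_const).continuousOn.integrableOn_compact hcpt).mono_set hsub
    have hsum : (fun x => u x - t) = fun x => (u x - g x) + (g x - t) := by ext; ring
    rw [energy_eq hP hi, ← setIntegral_sublevel_eq hE h1 h2, hsum, integral_add (hd hv) hi,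
      hW.setIntegral_sublevel hs1 hcal hJl hE hv.ne hP]
    congr 1
    field_simp
  have hPlt : fracPer s (u ⁻¹' Iio t) ≠ ⊤ :=
    hW.fracPer_ne_top hN hs0 hs1 hh hcal hu hC measurableSet_Iio (ramp_antitone 0 t)
      (ramp_lipschitz 0 t) (abs_ramp_le 0 t)
      (fun n r hr => ramp_eq_zero zero_le_one hr n) (tendsto_ramp_zero t)
  have hPle : fracPer s (u ⁻¹' Iic t) ≠ ⊤ :=
    hW.fracPer_ne_top hN hs0 hs1 hh hcal hu hC measurableSet_Iic (ramp_antitone 1 t)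
      (ramp_lipschitz 1 t) (abs_ramp_le 1 t)
      (fun n r hr => ramp_eq_zero le_rfl hr n) (tendsto_ramp_one t)
  have hElt := hval measurableSet_Iio (isLowerSet_Iio t) subset_rfl Iio_subset_Iic_self hPlt
  have hEle := hval measurableSet_Iic (isLowerSet_Iic t) Iio_subset_Iic_self subset_rfl hPle
  have hmin (F : Set (EuclideanSpace ℝ (Fin N))) (hF : NullMeasurableSet F) :
      ((1 / h * ∫ x, min (u x - t) 0 : ℝ) : EReal) ≤ energy s h (fun x => g x - t) F := by
    by_cases hE : energy s h (fun x => g x - t) F = ⊤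
    · rw [hE]; exact le_top
    · obtain ⟨hi, hle⟩ := hlow F hF hE
      refine le_trans (EReal.coe_le_coe_iff.2 ?_) hle
      exact mul_le_mul_of_nonneg_left (integral_min_le_setIntegral hu hF hi).1 (by positivity)
  have hextr (F : Set (EuclideanSpace ℝ (Fin N)))
      (hF : IsMinimizer (energy s h (fun x => g x - t)) F) :
      volume ({x | u x < t} \ F) = 0 ∧ volume (F \ {x | u x ≤ t}) = 0 := by
    have h1 := hF.2 _ (huc.measurable measurableSet_Iio : MeasurableSet (u ⁻¹' Iio t)).nullMeasurableSet
    rw [hElt] at h1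
    obtain ⟨hi, hle⟩ := hlow F hF.1 (ne_top_of_le_ne_top (EReal.coe_ne_top _) h1)
    refine (integral_min_le_setIntegral hu hF.1 hi).2 ?_
    have := EReal.coe_le_coe_iff.1 (hle.trans h1)
    exact le_of_mul_le_mul_left this (by positivity)
  refine ⟨⟨⟨(huc.measurable measurableSet_Iio).nullMeasurableSet, fun G hG => ?_⟩,
    fun G hG => (hextr G hG).1⟩,
    ⟨⟨(huc.measurable measurableSet_Iic).nullMeasurableSet, fun G hG => ?_⟩,
    fun G hG => (hextr G hG).2⟩⟩
  · exact hElt.le.trans (hmin G hG)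
  · exact hEle.le.trans (hmin G hG)

end Energy

end FracROF

namespace FracROF

/-! ### Symmetry under sign change and assembly of the theorem. -/

section Main

variable {N : ℕ} {s h : ℝ}

lemma neg_mem_LPlus {g : EuclideanSpace ℝ (Fin N) → ℝ} (hg : g ∈ LMinus N) :
    (fun x => -g x) ∈ LPlus N := by
  obtain ⟨⟨K, hK⟩, hlim⟩ := hg
  exact ⟨⟨K, hK.neg⟩, tendsto_neg_atBot_atTop.comp hlim⟩

lemma neg_mem_LMinus {g : EuclideanSpace ℝ (Fin N) → ℝ} (hg : g ∈ LPlus N) :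
    (fun x => -g x) ∈ LMinus N := by
  obtain ⟨⟨K, hK⟩, hlim⟩ := hg
  exact ⟨⟨K, hK.neg⟩, tendsto_neg_atTop_atBot.comp hlim⟩

lemma IsSolution.neg {g u : EuclideanSpace ℝ (Fin N) → ℝ} (hs : IsSolution s h g u) :
    IsSolution s h (fun x => -g x) (fun x => -u x) := by
  obtain ⟨z, ⟨hz1, hz2, hz3⟩, he⟩ := hs
  refine ⟨fun p => -z p, ⟨hz1.neg, ?_, ?_⟩, fun φ hφ hc => ?_⟩
  · exact (eLpNorm_neg z ⊤ volume).le.trans hz2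
  · filter_upwards [hz3] with p hp
    rw [show -u p.1 - -u p.2 = -(u p.1 - u p.2) by ring, abs_neg, neg_mul_neg, hp]
  · have := he φ hφ hc
    simp only [nonlocalDiv, neg_mul, integral_neg] at this ⊢
    linarith

lemma mem_LPlus_of_bounded_diff {g u : EuclideanSpace ℝ (Fin N) → ℝ} (hg : g ∈ LPlus N)
    {K : ℝ≥0} (hu : LipschitzWith K u) {C : ℝ} (hC : ∀ x, |u x - g x| ≤ C) : u ∈ LPlus N := by
  refine ⟨⟨K, hu⟩, tendsto_atTop_mono (fun x => ?_)
    (tendsto_atTop_add_const_right _ (-C) hg.2)⟩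
  linarith [(abs_le.1 (hC x)).1]

lemma IsSolution.of_weakEquation (hN : 1 ≤ N) (hs0 : 0 < s) (hs1 : s < 1)
    {g u : EuclideanSpace ℝ (Fin N) → ℝ}
    {z : EuclideanSpace ℝ (Fin N) × EuclideanSpace ℝ (Fin N) → ℝ} (hu : Continuous u)
    (hg : Continuous g) (hzm : Measurable z) (hzb : ∀ p, |z p| ≤ 1)
    (hcal : ∀ p, z p * (u p.1 - u p.2) = |u p.1 - u p.2|) (hW : WeakEquation s h g u z) :
    IsSolution s h g u := by
  have hzb' : ∀ᵐ p, ‖z p‖ ≤ 1 := ae_of_all _ hzb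
  refine ⟨z, ⟨memLp_top_of_bound hzm.aestronglyMeasurable 1 hzb', ?_, ae_of_all _ hcal⟩,
    fun φ hφ hc => ?_⟩
  · rw [eLpNorm_exponent_top]
    simpa using eLpNormEssSup_le_of_ae_bound hzb'
  · obtain ⟨L, hL⟩ := hφ.lipschitzWith_of_hasCompactSupport hc (by simp)
    have hi {f : EuclideanSpace ℝ (Fin N) → ℝ} (hf : Continuous f) :
        Integrable fun x => f x * φ x :=
      (hf.mul hφ.continuous).integrable_of_hasCompactSupport hc.mul_left
    have h1 := hW φ (hφ.continuous.integrable_of_hasCompactSupport hc)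
      (integrable_diff_mul_sKernel hN hs0 hs1 hL hc)
    simp_rw [sub_mul (u _)] at h1
    rw [integral_sub (hi hu) (hi hg)] at h1
    rw [nonlocalDiv_eq]
    linarith

theorem comparison (hN : 1 ≤ N) (hs0 : 0 < s) (hs1 : s < 1) (hh : 0 < h)
    {g₁ g₂ u₁ u₂ : EuclideanSpace ℝ (Fin N) → ℝ}
    (h₁ : g₁ ∈ LPlus N ∧ u₁ ∈ LPlus N ∨ g₁ ∈ LMinus N ∧ u₁ ∈ LMinus N)
    (h₂ : g₂ ∈ LPlus N ∧ u₂ ∈ LPlus N ∨ g₂ ∈ LMinus N ∧ u₂ ∈ LMinus N)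
    (hs₁ : IsSolution s h g₁ u₁) (hs₂ : IsSolution s h g₂ u₂) (hle : ∀ x, g₁ x ≤ g₂ x)
    (x : EuclideanSpace ℝ (Fin N)) : u₁ x ≤ u₂ x := by
  have hlip {g : EuclideanSpace ℝ (Fin N) → ℝ} (hg : g ∈ LPlus N ∨ g ∈ LMinus N) :
      ∃ K : ℝ≥0, LipschitzWith K g := hg.elim (·.1) (·.1)
  obtain ⟨_, hg₁⟩ := hlip (h₁.imp And.left And.left)
  obtain ⟨_, hg₂⟩ := hlip (h₂.imp And.left And.left)
  obtain ⟨_, hu₁⟩ := hlip (h₁.imp And.right And.right)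
  obtain ⟨_, hu₂⟩ := hlip (h₂.imp And.right And.right)
  rcases h₂ with h₂ | h₂
  · exact comparison_of_mem_LPlus hN hs0 hs1 hh hg₁.continuous hg₂.continuous hu₁ h₂.2 hs₁ hs₂
      hle x
  rcases h₁ with h₁ | h₁
  -- A datum in 𝓛⁺ cannot lie below one in 𝓛⁻: since N ≥ 1 there are points far out where the first
  -- is positive and the second negative.
  · have : Nonempty (Fin N) := ⟨⟨0, hN⟩⟩
    have : (Bornology.cobounded (EuclideanSpace ℝ (Fin N))).NeBot := inferInstance
    obtain ⟨y, hy₁, hy₂⟩ := ((h₁.1.2.eventually_gt_atTop 0).and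
      (h₂.1.2.eventually_lt_atBot 0)).exists
    linarith [hle y]
  · exact neg_le_neg_iff.1 (comparison_of_mem_LPlus hN hs0 hs1 hh hg₂.continuous.neg
      hg₁.continuous.neg hu₂.neg (neg_mem_LPlus h₁.2) hs₂.neg hs₁.neg
      (fun y => neg_le_neg (hle y)) x)

theorem exists_unique_solution_LPlus (hN : 1 ≤ N) (hs0 : 0 < s) (hs1 : s < 1) (hh : 0 < h)
    {g : EuclideanSpace ℝ (Fin N) → ℝ} (hg : g ∈ LPlus N) :
    ∃ u ∈ LPlus N, IsSolution s h g u ∧ (∀ v ∈ LPlus N, IsSolution s h g v → v = u) ∧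
      (∀ K : ℝ≥0, LipschitzWith K g → LipschitzWith K u) ∧
      ∀ t : ℝ, IsMinimalMinimizer (energy s h (fun x => g x - t)) {x | u x < t} ∧
        IsMaximalMinimizer (energy s h (fun x => g x - t)) {x | u x ≤ t} := by
  have huniq {v w : EuclideanSpace ℝ (Fin N) → ℝ} (hv : v ∈ LPlus N) (hw : w ∈ LPlus N)
      (hv' : IsSolution s h g v) (hw' : IsSolution s h g w) : v = w := by
    ext x
    exact le_antisymm
      (comparison hN hs0 hs1 hh (.inl ⟨hg, hv⟩) (.inl ⟨hg, hw⟩) hv' hw' (fun _ => le_rfl) x)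
      (comparison hN hs0 hs1 hh (.inl ⟨hg, hw⟩) (.inl ⟨hg, hv⟩) hw' hv' (fun _ => le_rfl) x)
  obtain ⟨K, hK⟩ := hg.1
  obtain ⟨u, z, huK, ⟨C, hC⟩, hzm, hzb, hcal, hW⟩ := exists_weak_solution hN hs0 hs1 hh hK
  have hu := mem_LPlus_of_bounded_diff hg huK hC
  have hsol : IsSolution s h g u :=
    .of_weakEquation hN hs0 hs1 huK.continuous hK.continuous hzm hzb hcal hW
  refine ⟨u, hu, hsol, fun v hv hv' => huniq hv hu hv' hsol, fun K' hK' => ?_,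
    WeakEquation.isMinimizer hW hN hs0 hs1 hh hzb hcal hu hg hC⟩
  -- The construction with the constant K' gives a K'-Lipschitz solution, which uniqueness
  -- identifies with u.
  obtain ⟨u', z', huK', ⟨C', hC'⟩, hzm', hzb', hcal', hW'⟩ :=
    exists_weak_solution hN hs0 hs1 hh hK'
  rwa [huniq hu (mem_LPlus_of_bounded_diff hg huK' hC') hsol
    (.of_weakEquation hN hs0 hs1 huK'.continuous hK.continuous hzm' hzb' hcal' hW')]

theorem exists_unique_solution_LMinus (hN : 1 ≤ N) (hs0 : 0 < s) (hs1 : s < 1) (hh : 0 < h)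
    {g : EuclideanSpace ℝ (Fin N) → ℝ} (hg : g ∈ LMinus N) :
    ∃ u ∈ LMinus N, IsSolution s h g u ∧ (∀ v ∈ LMinus N, IsSolution s h g v → v = u) ∧
      (∀ K : ℝ≥0, LipschitzWith K g → LipschitzWith K u) ∧
      ∀ t : ℝ, IsMinimalMinimizer (energy s h (fun x => t - g x)) {x | t < u x} ∧
        IsMaximalMinimizer (energy s h (fun x => t - g x)) {x | t ≤ u x} := by
  obtain ⟨u, hu, hsol, huniq, hlip, hmin⟩ :=
    exists_unique_solution_LPlus hN hs0 hs1 hh (neg_mem_LPlus hg)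
  refine ⟨fun x => -u x, neg_mem_LMinus hu, by simpa using hsol.neg, fun v hv hv' => ?_,
    fun K hK => (hlip K hK.neg).neg, fun t => ?_⟩
  · rw [← huniq _ (neg_mem_LPlus hv) hv'.neg]
    simp
  · have hf : (fun x => t - g x) = fun x => -g x - -t := by ext; ring
    have h1 : {x | t < -u x} = {x | u x < -t} := by ext x; exact lt_neg (a := t) (b := u x)
    have h2 : {x | t ≤ -u x} = {x | u x ≤ -t} := by ext x; exact le_neg (a := t) (b := u x)
    rw [hf, h1, h2]
    exact hmin (-t)

end Main

end FracROF

theorem theorem4p2 (N : ℕ) (hN : 1 ≤ N) (s : ℝ) (hs0 : 0 < s) (hs1 : s < 1)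
    (h : ℝ) (hh : 0 < h) :
    (∀ g ∈ FracROF.LPlus N, ∃ u ∈ FracROF.LPlus N,
      FracROF.IsSolution s h g u ∧
      (∀ v ∈ FracROF.LPlus N, FracROF.IsSolution s h g v → v = u) ∧
      (∀ K : ℝ≥0, LipschitzWith K g → LipschitzWith K u) ∧
      ∀ t : ℝ,
        FracROF.IsMinimalMinimizer (FracROF.energy s h (fun x => g x - t)) {x | u x < t} ∧
        FracROF.IsMaximalMinimizer (FracROF.energy s h (fun x => g x - t)) {x | u x ≤ t}) ∧
    (∀ g ∈ FracROF.LMinus N, ∃ u ∈ FracROF.LMinus N,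
      FracROF.IsSolution s h g u ∧
      (∀ v ∈ FracROF.LMinus N, FracROF.IsSolution s h g v → v = u) ∧
      (∀ K : ℝ≥0, LipschitzWith K g → LipschitzWith K u) ∧
      ∀ t : ℝ,
        FracROF.IsMinimalMinimizer (FracROF.energy s h (fun x => t - g x)) {x | t < u x} ∧
        FracROF.IsMaximalMinimizer (FracROF.energy s h (fun x => t - g x)) {x | t ≤ u x}) ∧
    (∀ g₁ g₂ u₁ u₂ : EuclideanSpace ℝ (Fin N) → ℝ,
      (g₁ ∈ FracROF.LPlus N ∧ u₁ ∈ FracROF.LPlus N ∨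
        g₁ ∈ FracROF.LMinus N ∧ u₁ ∈ FracROF.LMinus N) →
      (g₂ ∈ FracROF.LPlus N ∧ u₂ ∈ FracROF.LPlus N ∨
        g₂ ∈ FracROF.LMinus N ∧ u₂ ∈ FracROF.LMinus N) →
      FracROF.IsSolution s h g₁ u₁ → FracROF.IsSolution s h g₂ u₂ →
      (∀ x, g₁ x ≤ g₂ x) → ∀ x, u₁ x ≤ u₂ x)
  := ⟨fun _ hg => FracROF.exists_unique_solution_LPlus hN hs0 hs1 hh hg,
    fun _ hg => FracROF.exists_unique_solution_LMinus hN hs0 hs1 hh hg,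
    fun _ _ _ _ h₁ h₂ hs₁ hs₂ hle => FracROF.comparison hN hs0 hs1 hh h₁ h₂ hs₁ hs₂ hle⟩
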